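/- Let $\{X_t\}_{t\ge 0}$ be the stationary Ornstein–Uhlenbeck process $dX_t=\kappa(\theta-X_t)\,dt+\sigma\,dW_t$ with $\kappa,\sigma>0$, $W$ a standard Brownian motion and $X_0\sim\mathcal N(\theta,\sigma^2/(2\kappa))$ independent of $W$. Let the status updates be generated at the arrival times $t_1<t_2<\cdots$ of a Poisson process of rate $\lambda>0$ (the intervals $t_1,\,t_2-t_1,\,t_3-t_2,\dots$ are i.i.d. exponential of rate $\lambda$). The $i$-th update is received at a time $t_i'>t_i$ as $Y_{t_i'}=X_{t_i}+N_{t_i'}$, where the noise variables $N_{t_i'}$ are i.i.d. $\mathcal N(0,\sigma_n^2)$, $\sigma_n>0$, and independent of $X$. For given time instants, let $t_n'<t\le t_{n+1}'$ and $2\le m\le n$, and let the value of information be the mutual information (with natural logarithm) $$v(t)=I\big(X_t;\,Y_{t_n'},\dots,Y_{t_{n-m+1}'}\big).$$ Put $\gamma=\operatorname{Var}[X_{t_i}]/\operatorname{Var}[N_{t_i'}]=\sigma^2/(2\kappa\sigma_n^2)$. Then, for almost every realization of the sampling times, $v(t)$ is finite and in the high-SNR regime $1/\gamma\to0$ $$v(t)=\frac12\log\Big(\frac{1}{1-e^{-2\kappa(t-t_n)}}\Big)-\frac12\log\Big[1+\frac{1}{e^{2\kappa(t-t_n)}-1}\Big(\frac1\gamma-\frac{1}{1-e^{-2\kappa(t_n-t_{n-1})}}\,\frac1{\gamma^2}\Big)\Big]+O\Big(\frac1{\gamma^3}\Big),$$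 where the constant in $O(1/\gamma^3)$ and the threshold on $\gamma$ from which the bound holds depend only on $\kappa$, $t$, $m$, $n$ and the realized time instants (not on $\theta,\sigma,\sigma_n$ except through $\gamma$). -/

import Mathlib

open MeasureTheory ProbabilityTheory InformationTheory
open scoped NNReal ENNReal

namespace NoisyOU

/-- Mutual information (in nats) of two random variables: the Kullback-Leibler divergence of their
joint law from the product of their laws. -/
noncomputable def mutualInfo {Ω E F : Type*} [MeasurableSpace Ω] [MeasurableSpace E]
    [MeasurableSpace F] (P : Measure Ω) (U : Ω → E) (V : Ω → F) : ℝ≥0∞ :=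
  klDiv (P.map (fun ω ↦ (U ω, V ω))) ((P.map U).prod (P.map V))

/-- `X` is the stationary Ornstein-Uhlenbeck process driven by the Brownian motion `W`: a solution
with continuous paths of `dX_t = κ (θ - X_t) dt + σ dW_t` whose initial value is independent of `W`
and has law `N(θ, σ² / (2κ))`. As `σ` is constant, the equation is the pathwise integral equation
`X_t = X_0 + ∫₀ᵗ κ (θ - X_s) ds + σ W_t`. -/
structure IsStationaryOU {Ω : Type*} [MeasurableSpace Ω] (P : Measure Ω) (κ θ σ : ℝ)
    (W X : ℝ≥0 → Ω → ℝ) : Prop where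
  brownian : IsBrownianReal W P
  aemeasurable : ∀ t, AEMeasurable (X t) P
  continuous : ∀ᵐ ω ∂P, Continuous (fun t ↦ X t ω)
  init_law : HasLaw (X 0) (gaussianReal θ (Real.toNNReal (σ ^ 2 / (2 * κ)))) P
  init_indep : IndepFun (X 0) (fun ω t ↦ W t ω) P
  sde : ∀ᵐ ω ∂P, ∀ t : ℝ≥0,
    X t ω = X 0 ω + (∫ s in (0 : ℝ)..t, κ * (θ - X s.toNNReal ω)) + σ * W t ω

/-- The noise `N i` that corrupts the `i`-th update: i.i.d. centred Gaussian variables of variance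
`σn²`, independent of the process `X`. -/
structure IsChannelNoise {Ω : Type*} [MeasurableSpace Ω] (P : Measure Ω) (σn : ℝ)
    (X : ℝ≥0 → Ω → ℝ) (N : ℕ → Ω → ℝ) : Prop where
  law : ∀ i, HasLaw (N i) (gaussianReal 0 (Real.toNNReal (σn ^ 2))) P
  indep : iIndepFun N P
  indep_process : IndepFun (fun ω t ↦ X t ω) (fun ω i ↦ N i ω) P

/-- The observation of the `i`-th update, for the sampling instants `τ`. -/
def obs {Ω : Type*} (X : ℝ≥0 → Ω → ℝ) (N : ℕ → Ω → ℝ) (τ : ℕ → ℝ≥0) (i : ℕ) (ω : Ω) : ℝ :=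
  X (τ i) ω + N i ω

/-- The value of information at time `t` for given sampling instants `τ`: the mutual information of
the current status `X t` and the observations of the updates `n, n - 1, …, n - m + 1`. -/
noncomputable def voi {Ω : Type*} [MeasurableSpace Ω] (P : Measure Ω) (X : ℝ≥0 → Ω → ℝ)
    (N : ℕ → Ω → ℝ) (τ : ℕ → ℝ≥0) (n m : ℕ) (t : ℝ≥0) : ℝ≥0∞ :=
  mutualInfo P (X t) (fun ω (j : Fin m) ↦ obs X N τ (n - j) ω)

/-- The ratio `γ` of the stationary variance of the process and the variance of the noise. -/
noncomputable def snr (κ σ σn : ℝ) : ℝ := (σ ^ 2 / (2 * κ)) / σn ^ 2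

/-- `T 1, T 2, …` are the arrival times of a Poisson process of rate `lam` started at `T 0 = 0`:
the intervals between them are i.i.d. exponential variables of rate `lam`. -/
structure IsPoissonSampling {Ω : Type*} [MeasurableSpace Ω] (Q : Measure Ω) (lam : ℝ)
    (T : ℕ → Ω → ℝ≥0) : Prop where
  zero : ∀ᵐ ω ∂Q, T 0 ω = 0
  law : ∀ i, HasLaw (fun ω ↦ (T (i + 1) ω : ℝ) - T i ω) (expMeasure lam) Q
  indep : iIndepFun (fun i ω ↦ (T (i + 1) ω : ℝ) - T i ω) Q

end NoisyOU

namespace NoisyOU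

open Filter Topology Finset

/-! ### Discretization of a linear equation driven by an additive signal -/

/-! For fixed sampling times, the status and the observations are jointly Gaussian. The error of the
best linear prediction of `X t` is therefore independent of the observations, and the mutual
information is half the log of the ratio of the stationary variance to the error variance
(`mutualInfo_eq_of_regression`).

The Kalman recursion gives the error variance. A noisy observation turns a prior variance `r` into
`r q / (r + q)`, which lies in `[0, q]`, where `q` is the noise variance. Hence, whatever the older
observations are, the prior variance `ρ` just before the last update lies within `O(q)` of `s (1 -
b²)`, where `s` is the stationary variance and `b` the decay over the last sampling interval
(`IsStateSpace.exists_predictor`). In units of `s`, with `g = 1/γ` and `c = 1 - b²`, this gives `ρ g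
/ (ρ + g) = g - g²/c + O(g³)`: older observations enter at third order only. Since `log` is
1-Lipschitz on `[1, ∞)`, the error passes to the value of information.

Gaussianity needs no stochastic integral. The integral equation, read path by path, makes `X b - θ -
exp (-κ (b - a)) (X a - θ)` an almost sure limit of weighted sums of Brownian increments.
Covariances of these sums converge, so the limits are jointly Gaussian and the innovations are
uncorrelated (`isGaussianProcess_of_tendsto`). The Poisson law is used only to make the sampling
times almost surely strictly increasing. -/

lemma abs_integral_linear_sub_le {κ a b M ε : ℝ} {x φ : ℝ → ℝ} (hab : a ≤ b)
    (hx : Continuous x) (hφ : Continuous φ)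
    (hxM : ∀ u ∈ Set.Icc a b, |x u| ≤ M) (hφM : ∀ u ∈ Set.Icc a b, |φ u| ≤ M)
    (hxε : ∀ u ∈ Set.Icc a b, |x b - x u| ≤ ε) (hφε : ∀ u ∈ Set.Icc a b, |φ u - φ a| ≤ ε) :
    |(∫ u in a..b, κ * φ u) * x b - φ a * (κ * ∫ u in a..b, x u)|
      ≤ 2 * |κ| * M * ε * (b - a) := by
  have hI : (∫ u in a..b, κ * φ u) * x b - φ a * (κ * ∫ u in a..b, x u) =
      ∫ u in a..b, κ * (φ u * x b - φ a * x u) := by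
    rw [← intervalIntegral.integral_mul_const, ← intervalIntegral.integral_const_mul,
      ← intervalIntegral.integral_const_mul, ← intervalIntegral.integral_sub]
    · congr 1 with u; ring
    all_goals exact Continuous.intervalIntegrable (by fun_prop) _ _
  rw [hI, ← Real.norm_eq_abs, ← abs_of_nonneg (sub_nonneg.2 hab)]
  refine intervalIntegral.norm_integral_le_of_norm_le_const fun u hu ↦ ?_
  rw [Set.uIoc_of_le hab] at hu
  have hu' : u ∈ Set.Icc a b := ⟨hu.1.le, hu.2⟩
  have ha : a ∈ Set.Icc a b := ⟨le_rfl, hab⟩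
  have hb : b ∈ Set.Icc a b := ⟨hab, le_rfl⟩
  have hM : 0 ≤ M := (abs_nonneg _).trans (hxM b hb)
  -- Both products are close to `φ a * x b`, so the integrand is of order `ε`.
  have e : φ u * x b - φ a * x u = (φ u - φ a) * x b + φ a * (x b - x u) := by ring
  rw [Real.norm_eq_abs, abs_mul, e]
  have h1 : |(φ u - φ a) * x b + φ a * (x b - x u)| ≤ ε * M + M * ε := by
    refine (abs_add_le _ _).trans ?_
    rw [abs_mul, abs_mul]
    gcongr
    · exact (abs_nonneg _).trans (hφε u hu')
    · exact hφε u hu'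
    · exact hxM b hb
    · exact hφM a ha
    · exact hxε u hu'
  calc |κ| * _ ≤ |κ| * (ε * M + M * ε) := by gcongr
    _ = _ := by ring

/-- The `k`-th point of the subdivision of `[a, b]` into `n + 1` intervals of equal length. -/
noncomputable def grid (a b : ℝ) (n k : ℕ) : ℝ := a + k * ((b - a) / (n + 1))

lemma grid_zero (a b : ℝ) (n : ℕ) : grid a b n 0 = a := by simp [grid]

lemma grid_last (a b : ℝ) (n : ℕ) : grid a b n (n + 1) = b := by
  have : (n : ℝ) + 1 ≠ 0 := by positivity
  simp only [grid]; push_cast; field_simp; ring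

lemma grid_succ_sub (a b : ℝ) (n k : ℕ) :
    grid a b n (k + 1) - grid a b n k = (b - a) / (n + 1) := by
  simp only [grid]; push_cast; ring

lemma grid_mono {a b : ℝ} (hab : a ≤ b) (n : ℕ) : Monotone (grid a b n) := by
  refine monotone_nat_of_le_succ fun k ↦ ?_
  rw [← sub_nonneg, grid_succ_sub]
  exact div_nonneg (sub_nonneg.2 hab) (by positivity)

lemma grid_mem {a b : ℝ} (hab : a ≤ b) {n k : ℕ} (hk : k ≤ n + 1) :
    grid a b n k ∈ Set.Icc a b := by
  constructor
  · simpa [grid_zero] using grid_mono hab n (Nat.zero_le k)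
  · simpa [grid_last] using grid_mono hab n hk

/-- If `dx = -κ x ds + dw` on `[a, b]`, then the sums that approximate the integral of
`exp (-κ (b - s))` against `dw` converge to `x b - exp (-κ (b - a)) x a`. -/
lemma tendsto_sum_exp_mul_increment {κ a b : ℝ} (hab : a ≤ b) {x w : ℝ → ℝ} (hx : Continuous x)
    (h : ∀ s ∈ Set.Icc a b, ∀ t ∈ Set.Icc a b, s ≤ t →
      x t - x s = -κ * (∫ u in s..t, x u) + (w t - w s)) :
    Tendsto (fun n : ℕ ↦ ∑ k ∈ range (n + 1), Real.exp (-κ * (b - grid a b n k)) *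
      (w (grid a b n (k + 1)) - w (grid a b n k))) atTop
      (𝓝 (x b - Real.exp (-κ * (b - a)) * x a)) := by
  set φ : ℝ → ℝ := fun u ↦ Real.exp (-κ * (b - u)) with hφdef
  have hφ : Continuous φ := by fun_prop
  have hderiv : ∀ u, HasDerivAt φ (κ * φ u) u := fun u ↦ by
    have h1 : HasDerivAt (fun u ↦ -κ * (b - u)) κ u := by
      simpa using ((hasDerivAt_id u).const_sub b).const_mul (-κ)
    simpa [hφdef, mul_comm] using h1.exp
  have hint : ∀ s t, ∫ u in s..t, κ * φ u = φ t - φ s := fun s t ↦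
    intervalIntegral.integral_eq_sub_of_hasDerivAt (fun u _ ↦ hderiv u)
      (Continuous.intervalIntegrable (by fun_prop) _ _)
  obtain ⟨M₁, hM₁⟩ := isCompact_Icc.exists_bound_of_continuousOn (s := Set.Icc a b) hx.continuousOn
  obtain ⟨M₂, hM₂⟩ := isCompact_Icc.exists_bound_of_continuousOn (s := Set.Icc a b) hφ.continuousOn
  set M := max M₁ M₂ with hMdef
  have hM : 0 ≤ M := (norm_nonneg _).trans ((hM₁ a ⟨le_rfl, hab⟩).trans (le_max_left _ _))
  have ux := Metric.uniformContinuousOn_iff.1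
    (isCompact_Icc.uniformContinuousOn_of_continuous (s := Set.Icc a b) hx.continuousOn)
  have uφ := Metric.uniformContinuousOn_iff.1
    (isCompact_Icc.uniformContinuousOn_of_continuous (s := Set.Icc a b) hφ.continuousOn)
  rw [Metric.tendsto_atTop]
  intro ε hε
  -- `D - 1` is the total error per unit of oscillation; the extra 1 keeps `D` positive and the
  -- final inequality strict.
  set D := 2 * |κ| * M * (b - a) + 1 with hD
  have hDpos : 0 < D := by
    have : 0 ≤ 2 * |κ| * M * (b - a) := by
      have := sub_nonneg.2 hab
      positivity
    linarith
  obtain ⟨δ₁, hδ₁, h₁⟩ := ux (ε / D) (by positivity)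
  obtain ⟨δ₂, hδ₂, h₂⟩ := uφ (ε / D) (by positivity)
  obtain ⟨N, hN⟩ := exists_nat_gt ((b - a) / min δ₁ δ₂)
  refine ⟨N, fun n hn ↦ ?_⟩
  have hmesh : (b - a) / (n + 1) < min δ₁ δ₂ := by
    have hm : 0 < min δ₁ δ₂ := lt_min hδ₁ hδ₂
    rw [div_lt_iff₀ (by positivity)]
    rw [div_lt_iff₀ hm] at hN
    have : (N : ℝ) ≤ n := by exact_mod_cast hn
    nlinarith
  -- Discrete product rule: substituting the equation for the increment of `x` leaves exactly the
  -- difference bounded by `abs_integral_linear_sub_le`, which is of order oscillation times mesh.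
  have hcell : ∀ k ∈ range (n + 1),
      |φ (grid a b n (k + 1)) * x (grid a b n (k + 1)) - φ (grid a b n k) * x (grid a b n k)
        - φ (grid a b n k) * (w (grid a b n (k + 1)) - w (grid a b n k))|
      ≤ 2 * |κ| * M * (ε / D) * ((b - a) / (n + 1)) := fun k hk ↦ by
    have hk' : k + 1 ≤ n + 1 := by simpa using hk
    have m0 := grid_mem hab (n := n) (k := k) (by omega)
    have m1 := grid_mem hab hk'
    have hle : grid a b n k ≤ grid a b n (k + 1) := grid_mono hab n (Nat.le_succ k)
    have hlen := grid_succ_sub a b n k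
    have hsub : Set.Icc (grid a b n k) (grid a b n (k + 1)) ⊆ Set.Icc a b :=
      Set.Icc_subset_Icc m0.1 m1.2
    have := abs_integral_linear_sub_le (κ := κ) (M := M) (ε := ε / D) hle hx hφ
      (fun u hu ↦ (hM₁ u (hsub hu)).trans (le_max_left _ _))
      (fun u hu ↦ (hM₂ u (hsub hu)).trans (le_max_right _ _))
      (fun u hu ↦ by
        refine (h₁ _ m1 _ (hsub hu) ?_).le
        rw [Real.dist_eq, abs_of_nonneg (sub_nonneg.2 hu.2)]
        have := hmesh.trans_le (min_le_left _ _)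
        linarith [hu.1])
      (fun u hu ↦ by
        refine (h₂ _ (hsub hu) _ m0 ?_).le
        rw [Real.dist_eq, abs_of_nonneg (sub_nonneg.2 hu.1)]
        have := hmesh.trans_le (min_le_right _ _)
        linarith [hu.2])
    rw [hint, hlen] at this
    convert! this using 2
    have hw := h _ m0 _ m1 hle
    linear_combination φ (grid a b n k) * hw
  have htel : x b - Real.exp (-κ * (b - a)) * x a = ∑ k ∈ range (n + 1),
      (φ (grid a b n (k + 1)) * x (grid a b n (k + 1)) - φ (grid a b n k) * x (grid a b n k)) := by
    rw [Finset.sum_range_sub (fun k ↦ φ (grid a b n k) * x (grid a b n k)), grid_zero, grid_last]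
    simp [hφdef]
  rw [dist_comm, Real.dist_eq, htel, ← Finset.sum_sub_distrib]
  refine (Finset.abs_sum_le_sum_abs _ _).trans_lt ((Finset.sum_le_sum hcell).trans_lt ?_)
  rw [Finset.sum_const, card_range, nsmul_eq_mul]
  have hn1 : (n : ℝ) + 1 ≠ 0 := by positivity
  have : ((n + 1 : ℕ) : ℝ) * (2 * |κ| * M * (ε / D) * ((b - a) / (n + 1)))
      = (D - 1) * ε / D := by
    push_cast; rw [hD]; field_simp; ring
  rw [this, div_lt_iff₀ hDpos]
  nlinarith

/-! ### The Kalman filter for a bilinear form -/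

section Kalman

variable {V : Type*} [AddCommGroup V] [Module ℝ V] {B : LinearMap.BilinForm ℝ V}

lemma bilin_eq_zero_of_mem_span {S : Set V} {u h : V} (hu : ∀ y ∈ S, B u y = 0)
    (hh : h ∈ Submodule.span ℝ S) : B u h = 0 := by
  have : Submodule.span ℝ S ≤ LinearMap.ker (B u) :=
    Submodule.span_le.2 fun y hy ↦ by simpa using hu y hy
  simpa using this hh

/-- The update step: the best linear estimator of `x` given `S` is improved by a noisy observation
`x + ν` of `x`. -/
lemma exists_estimator_insert (hB : ∀ u v, B u v = B v u) {S : Set V} {x h ν : V} {r q : ℝ}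
    (hr : 0 < r) (hq : 0 < q) (hh : h ∈ Submodule.span ℝ S) (hS : ∀ y ∈ S, B (x - h) y = 0)
    (hrr : B (x - h) (x - h) = r) (hxν : B x ν = 0) (hνS : ∀ y ∈ S, B ν y = 0)
    (hνν : B ν ν = q) :
    ∃ h' ∈ Submodule.span ℝ (insert (x + ν) S), (∀ y ∈ insert (x + ν) S, B (x - h') y = 0) ∧
      B (x - h') (x - h') = r * q / (r + q) := by
  -- The Kalman gain: `(1 - K) r = K q` is what makes the new error orthogonal to `x + ν`.
  set K := r / (r + q) with hK
  have hrq : r + q ≠ 0 := by positivity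
  have hνh : B ν h = 0 := bilin_eq_zero_of_mem_span hνS hh
  have heν : B (x - h) ν = 0 := by simp [hxν, hB h ν, hνh]
  have heh : B (x - h) h = 0 := bilin_eq_zero_of_mem_span hS hh
  have hex : B (x - h) x = r := by
    have : B (x - h) (x - h) = B (x - h) x - B (x - h) h := map_sub _ _ _
    linarith
  have e : x - (h + K • (x + ν - h)) = (1 - K) • (x - h) - K • ν := by module
  have hmono : Submodule.span ℝ S ≤ Submodule.span ℝ (insert (x + ν) S) :=
    Submodule.span_mono (Set.subset_insert _ _)
  refine ⟨h + K • (x + ν - h), add_mem (hmono hh) (Submodule.smul_mem _ _ (sub_mem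
    (Submodule.subset_span (Set.mem_insert _ _)) (hmono hh))), ?_, ?_⟩
  · rw [e]
    intro y hy
    rcases Set.mem_insert_iff.1 hy with rfl | hy
    · have : B ((1 - K) • (x - h) - K • ν) (x + ν) = (1 - K) * (B (x - h) x + B (x - h) ν)
          - K * (B ν x + B ν ν) := by
        rw [map_sub, map_smul, map_smul, LinearMap.sub_apply, LinearMap.smul_apply,
          LinearMap.smul_apply, map_add, map_add, smul_eq_mul, smul_eq_mul]
      rw [this, hex, heν, hB ν x, hxν, hνν, hK]
      field_simp
      ring
    · rw [map_sub, map_smul, map_smul, LinearMap.sub_apply, LinearMap.smul_apply,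
          LinearMap.smul_apply, hS y hy, hνS y hy]
      simp
  · rw [e]
    have : B ((1 - K) • (x - h) - K • ν) ((1 - K) • (x - h) - K • ν) =
        (1 - K) * ((1 - K) * B (x - h) (x - h) - K * B (x - h) ν)
          - K * ((1 - K) * B ν (x - h) - K * B ν ν) := by
      rw [map_sub (B _), map_smul (B _), map_smul (B _), map_sub B, map_smul B, map_smul B]
      simp only [LinearMap.sub_apply, LinearMap.smul_apply, smul_eq_mul]
      ring
    rw [this, hrr, heν, hB ν, heν, hνν, hK]
    field_simp
    ring

/-- The prediction step: the best linear estimator of `x` given `S` yields that of `x'` if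
`x' - b • x` is uncorrelated with `x` and `S`. -/
lemma predict_estimator (hB : ∀ u v, B u v = B v u) {S : Set V} {x x' h : V} {b s p : ℝ}
    (hh : h ∈ Submodule.span ℝ S) (hS : ∀ y ∈ S, B (x - h) y = 0) (hp : B (x - h) (x - h) = p)
    (hx : B x x = s) (hx' : B x' x' = s) (hinn : B (x' - b • x) x = 0)
    (hinnS : ∀ y ∈ S, B (x' - b • x) y = 0) :
    b • h ∈ Submodule.span ℝ S ∧ (∀ y ∈ S, B (x' - b • h) y = 0) ∧
      B (x' - b • h) (x' - b • h) = s * (1 - b ^ 2) + b ^ 2 * p := by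
  set ξ := x' - b • x with hξ
  have hx'e : x' = b • x + ξ := by rw [hξ]; abel
  have e : x' - b • h = b • (x - h) + ξ := by rw [hξ]; module
  have hξh : B ξ h = 0 := bilin_eq_zero_of_mem_span hinnS hh
  have hξe : B ξ (x - h) = 0 := by simp [hinn, hξh]
  -- Stationarity forces the variance of the innovation: `x` and `x'` both have variance `s`.
  have hξξ : B ξ ξ = s * (1 - b ^ 2) := by
    have : B x' x' = b * (b * B x x + B x ξ) + (b * B ξ x + B ξ ξ) := by
      rw [hx'e, map_add B, map_smul B]
      simp only [LinearMap.add_apply, LinearMap.smul_apply, map_add, map_smul, smul_eq_mul]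
      ring
    rw [hB x ξ, hinn, hx, hx'] at this
    linarith
  refine ⟨Submodule.smul_mem _ _ hh, fun y hy ↦ ?_, ?_⟩
  · rw [e, map_add, map_smul, LinearMap.add_apply, LinearMap.smul_apply, hS y hy, hinnS y hy]
    simp
  · rw [e]
    have : B (b • (x - h) + ξ) (b • (x - h) + ξ) =
        b * (b * B (x - h) (x - h) + B (x - h) ξ) + (b * B ξ (x - h) + B ξ ξ) := by
      rw [map_add B, map_smul B, LinearMap.add_apply, LinearMap.smul_apply, map_add (B _),
        map_add (B _), map_smul (B _), map_smul (B _)]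
      simp only [smul_eq_mul]
    rw [this, hB (x - h) ξ, hξe, hξξ, hp]
    ring

/-- A stationary autoregressive sequence of variance `s` and a white noise of variance `q`, with
respect to a bilinear form. -/
structure IsStateSpace (B : LinearMap.BilinForm ℝ V) (x ν : ℕ → V) (b : ℕ → ℝ) (s q : ℝ) :
    Prop where
  symm : ∀ u v, B u v = B v u
  state_self : ∀ j, B (x j) (x j) = s
  innovation : ∀ j, ∀ i ≤ j, B (x (j + 1) - b j • x j) (x i) = 0
  noise_self : ∀ i, B (ν i) (ν i) = q
  noise_ne : ∀ i j, i ≠ j → B (ν i) (ν j) = 0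
  state_noise : ∀ i j, B (x i) (ν j) = 0

namespace IsStateSpace

variable {x ν : ℕ → V} {b : ℕ → ℝ} {s q : ℝ} (H : IsStateSpace B x ν b s q)
include H

lemma innovation_obs {i j : ℕ} (hij : i ≤ j) : B (x (j + 1) - b j • x j) (x i + ν i) = 0 := by
  rw [map_add, H.innovation j i hij]
  simp [H.state_noise]

lemma noise_obs {i j : ℕ} (hij : i ≠ j) : B (ν j) (x i + ν i) = 0 := by
  rw [map_add, H.symm, H.state_noise, H.noise_ne j i hij.symm, add_zero]

/-- Induction that alternates prediction and update. The bound `p ≤ q` is carried along because it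
alone confines the next prior variance `r` to an interval free of the earlier history. -/
lemma exists_estimator (hs : 0 < s) (hq : 0 < q) {j k : ℕ} (hkj : k ≤ j)
    (hb : ∀ i, k ≤ i → i < j → b i ^ 2 < 1) :
    ∃ h ∈ Submodule.span ℝ ((fun i ↦ x i + ν i) '' Set.Icc k j),
      (∀ y ∈ (fun i ↦ x i + ν i) '' Set.Icc k j, B (x j - h) y = 0) ∧
      ∃ p, 0 ≤ p ∧ p ≤ q ∧ B (x j - h) (x j - h) = p ∧
        (k < j → ∃ r, s * (1 - b (j - 1) ^ 2) ≤ r ∧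
          r ≤ s * (1 - b (j - 1) ^ 2) + b (j - 1) ^ 2 * q ∧ p = r * q / (r + q)) := by
  have upd : ∀ r : ℝ, 0 < r → 0 ≤ r * q / (r + q) ∧ r * q / (r + q) ≤ q := fun r hr ↦ by
    refine ⟨by positivity, ?_⟩
    rw [div_le_iff₀ (by positivity)]
    nlinarith [mul_pos hq hq]
  induction j, hkj using Nat.le_induction with
  | base =>
    -- Before any observation the estimator is 0 and the prior variance is `s`.
    obtain ⟨h', hh', ho, hv⟩ := exists_estimator_insert (B := B) H.symm (S := ∅) (x := x k) (h := 0)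
      (ν := ν k) hs hq (zero_mem _) (by simp) (by simpa using H.state_self k)
      (H.state_noise k k) (by simp) (H.noise_self k)
    have e : (fun i ↦ x i + ν i) '' Set.Icc k k = insert (x k + ν k) ∅ := by simp
    rw [e]
    exact ⟨h', hh', ho, _, (upd s hs).1, (upd s hs).2, hv, fun h ↦ absurd h (lt_irrefl k)⟩
  | succ j hkj ih =>
    obtain ⟨h, hh, ho, p, hp0, hpq, hp, -⟩ := ih fun i h1 h2 ↦ hb i h1 (by omega)
    obtain ⟨m1, m2, m3⟩ := predict_estimator (B := B) H.symm (x' := x (j + 1)) (b := b j) hh ho hp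
      (H.state_self j) (H.state_self (j + 1)) (H.innovation j j le_rfl) (by
        rintro _ ⟨i, hi, rfl⟩
        exact H.innovation_obs hi.2)
    have hbj : b j ^ 2 < 1 := hb j hkj (by omega)
    have hr : 0 < s * (1 - b j ^ 2) + b j ^ 2 * p := by
      have : 0 < s * (1 - b j ^ 2) := mul_pos hs (by linarith)
      positivity
    obtain ⟨h', hh', ho', hv⟩ := exists_estimator_insert (B := B) H.symm (ν := ν (j + 1)) hr hq
      m1 m2 m3 (H.state_noise _ _) (by
        rintro _ ⟨i, hi, rfl⟩
        exact H.noise_obs (by have := hi.2; omega)) (H.noise_self _)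
    have e : (fun i ↦ x i + ν i) '' Set.Icc k (j + 1) =
        insert (x (j + 1) + ν (j + 1)) ((fun i ↦ x i + ν i) '' Set.Icc k j) := by
      rw [← Set.image_insert_eq (f := fun i ↦ x i + ν i)]
      congr 1
      ext i
      simp only [Set.mem_insert_iff, Set.mem_Icc]
      omega
    rw [e]
    refine ⟨h', hh', ho', _, (upd _ hr).1, (upd _ hr).2, hv, fun _ ↦ ⟨_, ?_, ?_, rfl⟩⟩
    · simp only [Nat.add_sub_cancel]
      have := mul_nonneg (sq_nonneg (b j)) hp0
      linarith
    · simp only [Nat.add_sub_cancel]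
      gcongr

/-- The error variance of the best linear prediction of the next state from at least two
observations. -/
lemma exists_predictor (hs : 0 < s) (hq : 0 < q) {n k : ℕ} (hkn : k < n)
    (hb : ∀ i, k ≤ i → i < n → b i ^ 2 < 1) :
    ∃ h ∈ Submodule.span ℝ ((fun i ↦ x i + ν i) '' Set.Icc k n),
      (∀ y ∈ (fun i ↦ x i + ν i) '' Set.Icc k n, B (x (n + 1) - h) y = 0) ∧
      ∃ r, s * (1 - b (n - 1) ^ 2) ≤ r ∧ r ≤ s * (1 - b (n - 1) ^ 2) + b (n - 1) ^ 2 * q ∧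
        B (x (n + 1) - h) (x (n + 1) - h) =
          s * (1 - b n ^ 2) + b n ^ 2 * (r * q / (r + q)) := by
  obtain ⟨h, hh, ho, p, -, -, hp, hr⟩ := H.exists_estimator hs hq hkn.le hb
  obtain ⟨r, h1, h2, rfl⟩ := hr hkn
  obtain ⟨m1, m2, m3⟩ := predict_estimator (B := B) H.symm (x' := x (n + 1)) (b := b n) hh ho hp
    (H.state_self n) (H.state_self (n + 1)) (H.innovation n n le_rfl) (by
      rintro _ ⟨i, hi, rfl⟩
      exact H.innovation_obs hi.2)
  exact ⟨_, m1, m2, r, h1, h2, m3⟩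

end IsStateSpace

end Kalman

/-! ### The high-SNR expansion -/

/-- From `log (u / v) ≤ u / v - 1` and `v ≥ 1`. -/
lemma log_sub_log_le {u v : ℝ} (hu : 1 ≤ u) (hv : 1 ≤ v) :
    Real.log u - Real.log v ≤ |u - v| := by
  have hv0 : 0 < v := by linarith
  rw [← Real.log_div (by positivity) (by positivity)]
  refine (Real.log_le_sub_one_of_pos (by positivity)).trans ?_
  have : u / v - 1 = (u - v) / v := by field_simp
  rw [this, div_le_iff₀ hv0]
  nlinarith [le_abs_self (u - v), abs_nonneg (u - v)]

lemma abs_log_sub_log_le {u v : ℝ} (hu : 1 ≤ u) (hv : 1 ≤ v) :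
    |Real.log u - Real.log v| ≤ |u - v| :=
  abs_sub_le_iff.2 ⟨log_sub_log_le hu hv, abs_sub_comm u v ▸ log_sub_log_le hv hu⟩

/-- The difference is exactly `g² (ρ + g - c) / (c (ρ + g))`, with `ρ + g - c ≤ 2 g` and `ρ + g ≥
c`. -/
lemma abs_harmonic_sub_expansion_le {c g ρ : ℝ} (hc : 0 < c) (hg : 0 < g) (h1 : c ≤ ρ)
    (h2 : ρ ≤ c + g) : |ρ * g / (ρ + g) - (g - 1 / c * g ^ 2)| ≤ 2 / c ^ 2 * g ^ 3 := by
  have hρ : 0 < ρ := by linarith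
  have e : ρ * g / (ρ + g) - (g - 1 / c * g ^ 2) = g ^ 2 * (ρ + g - c) / (c * (ρ + g)) := by
    field_simp; ring
  rw [e, abs_of_nonneg (div_nonneg (mul_nonneg (sq_nonneg g) (by linarith)) (by positivity))]
  have e2 : 2 / c ^ 2 * g ^ 3 = g ^ 2 * (2 * g) / (c * c) := by field_simp
  rw [e2]
  gcongr <;> linarith

variable {Ω : Type*} [MeasurableSpace Ω] {P : Measure Ω}

/-! ### Gaussian processes -/

/-- Characteristic functions converge by dominated convergence; the limit variance may be zero. -/
lemma hasLaw_gaussianReal_of_tendsto [IsProbabilityMeasure P] {Z : ℕ → Ω → ℝ} {Z' : Ω → ℝ}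
    {v : ℕ → ℝ≥0} {v' : ℝ≥0} (hZ : ∀ n, HasLaw (Z n) (gaussianReal 0 (v n)) P)
    (hlim : ∀ᵐ ω ∂P, Tendsto (fun n ↦ Z n ω) atTop (𝓝 (Z' ω)))
    (hv : Tendsto v atTop (𝓝 v')) : HasLaw Z' (gaussianReal 0 v') P := by
  have hm : AEMeasurable Z' P :=
    aemeasurable_of_tendsto_metrizable_ae atTop (fun n ↦ (hZ n).aemeasurable) hlim
  refine ⟨hm, ?_⟩
  have : IsProbabilityMeasure (P.map Z') := Measure.isProbabilityMeasure_map hm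
  refine Measure.ext_of_charFun (funext fun t ↦ ?_)
  have h1 : Tendsto (fun n ↦ charFun (P.map (Z n)) t) atTop (𝓝 (charFun (P.map Z') t)) := by
    have e : ∀ {Y : Ω → ℝ}, AEMeasurable Y P →
        charFun (P.map Y) t = ∫ ω, Complex.exp (t * Y ω * Complex.I) ∂P := fun hY ↦ by
      rw [charFun_apply_real, integral_map hY (by fun_prop)]
    simp_rw [e hm, fun n ↦ e (hZ n).aemeasurable]
    refine tendsto_integral_of_dominated_convergence (fun _ ↦ 1) (fun n ↦ ?_) (by simp)
      (fun n ↦ ae_of_all _ fun ω ↦ ?_) ?_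
    · have := (hZ n).aemeasurable
      exact AEMeasurable.aestronglyMeasurable (by fun_prop)
    · rw [← Complex.ofReal_mul, Complex.norm_exp_ofReal_mul_I]
    · filter_upwards [hlim] with ω hω
      have hc : Continuous fun z : ℝ ↦ Complex.exp (t * z * Complex.I) := by fun_prop
      exact (hc.tendsto _).comp hω
  have h2 : Tendsto (fun n ↦ charFun (P.map (Z n)) t) atTop
      (𝓝 (charFun (gaussianReal 0 v') t)) := by
    simp_rw [fun n ↦ (hZ n).map_eq, charFun_gaussianReal]
    have hv2 : Tendsto (fun n ↦ ((v n : ℝ) : ℂ)) atTop (𝓝 ((v' : ℝ) : ℂ)) :=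
      (Complex.continuous_ofReal.tendsto _).comp ((NNReal.continuous_coe.tendsto _).comp hv)
    exact (Complex.continuous_exp.tendsto _).comp
      (tendsto_const_nhds.sub ((hv2.mul tendsto_const_nhds).div_const _))
  exact tendsto_nhds_unique h1 h2

/-- Every linear functional on `ι → ℝ` is a combination of coordinates, so one-dimensional laws
suffice. -/
lemma hasGaussianLaw_pi_of_forall_hasLaw_sum {ι : Type*} [Fintype ι] {U : ι → Ω → ℝ}
    (hm : ∀ i, AEMeasurable (U i) P)
    (h : ∀ c : ι → ℝ, ∃ v : ℝ≥0, HasLaw (fun ω ↦ ∑ i, c i * U i ω) (gaussianReal 0 v) P) :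
    HasGaussianLaw (fun ω i ↦ U i ω) P := by
  classical
  have hm' : AEMeasurable (fun ω i ↦ U i ω) P := aemeasurable_pi_lambda _ hm
  refine ⟨⟨fun L ↦ ?_⟩⟩
  obtain ⟨v, hv⟩ := h fun i ↦ L (Pi.single i 1)
  have e : (L ∘ fun ω i ↦ U i ω) = fun ω ↦ ∑ i, L (Pi.single i 1) * U i ω := by
    ext ω
    simp only [Function.comp_apply]
    conv_lhs => rw [← Finset.univ_sum_single (fun i ↦ U i ω), map_sum]
    refine sum_congr rfl fun i _ ↦ ?_
    rw [mul_comm, ← smul_eq_mul, ← map_smul, ← Pi.single_smul, smul_eq_mul, mul_one]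
  have hmap : (P.map fun ω i ↦ U i ω).map L = gaussianReal 0 v := by
    rw [AEMeasurable.map_map_of_aemeasurable (by fun_prop) hm', e, hv.map_eq]
  have hint : (P.map fun ω i ↦ U i ω)[L] = 0 := by
    have : ∫ x, L x ∂(P.map fun ω i ↦ U i ω) = ∫ y, y ∂((P.map fun ω i ↦ U i ω).map L) := by
      rw [integral_map (φ := L) (by fun_prop) (by fun_prop)]
    rw [this, hmap, integral_id_gaussianReal]
  have hvar : Var[L; P.map fun ω i ↦ U i ω] = v := by
    have : Var[fun y ↦ y; (P.map fun ω i ↦ U i ω).map L] = Var[L; P.map fun ω i ↦ U i ω] := by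
      rw [variance_map (by fun_prop) (by fun_prop)]
      rfl
    rw [← this, hmap, variance_fun_id_gaussianReal]
  rw [hmap, hint, hvar, Real.toNNReal_coe]

/-- Indices are chosen through `f`, repetitions allowed, so that finite subsets, single indices and
pairs are treated at once. -/
lemma exists_hasLaw_sum_of_tendsto {ι κ : Type*} [Fintype κ] {U : ℕ → ι → Ω → ℝ}
    {U' : ι → Ω → ℝ} {K : ι → ι → ℝ} (hU : ∀ n, IsGaussianProcess (U n) P)
    (h0 : ∀ n i, P[U n i] = 0)
    (hK : ∀ i j, Tendsto (fun n ↦ cov[U n i, U n j; P]) atTop (𝓝 (K i j)))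
    (hlim : ∀ i, ∀ᵐ ω ∂P, Tendsto (fun n ↦ U n i ω) atTop (𝓝 (U' i ω))) (f : κ → ι) (c : κ → ℝ) :
    ∃ v : ℝ≥0, v = ∑ a, ∑ b, c a * (c b * K (f a) (f b)) ∧
      HasLaw (fun ω ↦ ∑ a, c a * U' (f a) ω) (gaussianReal 0 v) P := by
  have : IsProbabilityMeasure P := (hU 0).isProbabilityMeasure
  have hg : ∀ n, IsGaussianProcess (fun (a : κ) ω ↦ c a * U n (f a) ω) P := fun n ↦
    ((hU n).comp_right f).smul c
  have hvar : ∀ n, Var[fun ω ↦ ∑ a, c a * U n (f a) ω; P] =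
      ∑ a, ∑ b, c a * (c b * cov[U n (f a), U n (f b); P]) := fun n ↦ by
    rw [← covariance_self ((hg n).hasGaussianLaw_fun_sum (I := univ)).aemeasurable,
      covariance_fun_sum_fun_sum (fun a ↦ ((hg n).hasGaussianLaw_eval a).memLp_two)
      (fun a ↦ ((hg n).hasGaussianLaw_eval a).memLp_two)]
    simp_rw [covariance_const_mul_left, covariance_const_mul_right]
  have hvlim : Tendsto (fun n ↦ Var[fun ω ↦ ∑ a, c a * U n (f a) ω; P]) atTop
      (𝓝 (∑ a, ∑ b, c a * (c b * K (f a) (f b)))) := by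
    simp_rw [hvar]
    exact tendsto_finsetSum _ fun a _ ↦
        tendsto_finsetSum _ fun b _ ↦ ((hK _ _).const_mul _).const_mul _
  refine ⟨(∑ a, ∑ b, c a * (c b * K (f a) (f b))).toNNReal, Real.coe_toNNReal _
    (ge_of_tendsto' hvlim fun n ↦ variance_nonneg _ _), ?_⟩
  refine hasLaw_gaussianReal_of_tendsto (Z := fun n ω ↦ ∑ a, c a * U n (f a) ω)
    (v := fun n ↦ (Var[fun ω ↦ ∑ a, c a * U n (f a) ω; P]).toNNReal)
    (fun n ↦ ?_) ?_ ((continuous_real_toNNReal.tendsto _).comp hvlim)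
  · have hs := (hg n).hasGaussianLaw_fun_sum (I := univ)
    refine ⟨hs.aemeasurable, ?_⟩
    rw [hs.map_eq_gaussianReal]
    congr 1
    rw [integral_finsetSum _ fun a _ ↦ ((hg n).hasGaussianLaw_eval a).integrable]
    simp [integral_const_mul, h0]
  · filter_upwards [ae_all_iff.2 fun a ↦ hlim (f a)] with ω hω
    exact tendsto_finsetSum _ fun a _ ↦ (hω a).const_mul _

/-- An almost sure limit of centred Gaussian processes whose covariances converge is a Gaussian
process with the limiting covariances. -/
lemma isGaussianProcess_of_tendsto {ι : Type*} {U : ℕ → ι → Ω → ℝ} {U' : ι → Ω → ℝ}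
    {K : ι → ι → ℝ} (hU : ∀ n, IsGaussianProcess (U n) P) (h0 : ∀ n i, P[U n i] = 0)
    (hK : ∀ i j, Tendsto (fun n ↦ cov[U n i, U n j; P]) atTop (𝓝 (K i j)))
    (hlim : ∀ i, ∀ᵐ ω ∂P, Tendsto (fun n ↦ U n i ω) atTop (𝓝 (U' i ω))) :
    IsGaussianProcess U' P ∧ (∀ i, P[U' i] = 0) ∧ ∀ i j, cov[U' i, U' j; P] = K i j := by
  have : IsProbabilityMeasure P := (hU 0).isProbabilityMeasure
  have hm : ∀ i, AEMeasurable (U' i) P := fun i ↦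
    aemeasurable_of_tendsto_metrizable_ae atTop (fun n ↦ (hU n).aemeasurable i) (hlim i)
  have hG : IsGaussianProcess U' P := ⟨fun I ↦
    hasGaussianLaw_pi_of_forall_hasLaw_sum (fun i ↦ hm i) fun c ↦
    (exists_hasLaw_sum_of_tendsto hU h0 hK hlim (fun i : I ↦ (i : ι)) c).imp fun _ h ↦ h.2⟩
  have hone : ∀ i, ∃ v : ℝ≥0, v = K i i ∧ HasLaw (U' i) (gaussianReal 0 v) P := fun i ↦ by
    simpa using exists_hasLaw_sum_of_tendsto hU h0 hK hlim (fun _ : Unit ↦ i) (fun _ ↦ 1)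
  have hvar : ∀ i, Var[U' i; P] = K i i := fun i ↦ by
    obtain ⟨v, hv, hl⟩ := hone i
    rw [hl.variance_eq, variance_id_gaussianReal, hv]
  have hKsymm : ∀ i j, K i j = K j i := fun i j ↦ by
    refine tendsto_nhds_unique (hK i j) ?_
    simp_rw [covariance_comm (U _ i)]
    exact hK j i
  refine ⟨hG, fun i ↦ ?_, fun i j ↦ ?_⟩
  · obtain ⟨v, -, hl⟩ := hone i
    rw [hl.integral_eq, integral_id_gaussianReal]
  -- Polarization: the covariance is read off the variance of `U' i + U' j`.
  · obtain ⟨v, hv, hl⟩ := exists_hasLaw_sum_of_tendsto hU h0 hK hlim ![i, j] ![1, 1]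
    simp only [Fin.sum_univ_two, Matrix.cons_val_zero, Matrix.cons_val_one, one_mul] at hv hl
    have h2 := hl.variance_eq
    rw [variance_id_gaussianReal, hv, variance_fun_add (hG.hasGaussianLaw_eval i).memLp_two
      (hG.hasGaussianLaw_eval j).memLp_two, hvar, hvar, hKsymm j i] at h2
    linarith

/-- Two independent Gaussian processes are jointly Gaussian. -/
lemma isGaussianProcess_sumElim {S T : Type*} {X : S → Ω → ℝ} {Y : T → Ω → ℝ}
    (hX : IsGaussianProcess X P) (hY : IsGaussianProcess Y P)
    (h : IndepFun (fun ω s ↦ X s ω) (fun ω t ↦ Y t ω) P) :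
    IsGaussianProcess (Sum.elim X Y) P where
  hasGaussianLaw I := by
    classical
    have hind : IndepFun (fun ω ↦ I.toLeft.restrict (X · ω))
        (fun ω ↦ I.toRight.restrict (Y · ω)) P :=
      h.comp (φ := fun x ↦ I.toLeft.restrict x) (ψ := fun y ↦ I.toRight.restrict y)
        (by fun_prop) (by fun_prop)
    let L : ((I.toLeft → ℝ) × (I.toRight → ℝ)) →ₗ[ℝ] (I → ℝ) :=
      { toFun p i := match i with
          | ⟨.inl s, hs⟩ => p.1 ⟨s, by simpa using hs⟩
          | ⟨.inr t, ht⟩ => p.2 ⟨t, by simpa using ht⟩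
        map_add' p q := by ext ⟨i | i, hi⟩ <;> rfl
        map_smul' c p := by ext ⟨i | i, hi⟩ <;> rfl }
    have e : (fun ω ↦ I.restrict (Sum.elim X Y · ω)) = L.toContinuousLinearMap ∘
        fun ω ↦ (I.toLeft.restrict (X · ω), I.toRight.restrict (Y · ω)) := by
      ext ω ⟨i | i, hi⟩ <;> rfl
    rw [e]
    exact (hind.hasGaussianLaw (hX.hasGaussianLaw _) (hY.hasGaussianLaw _)).map _

lemma isGaussianProcess_of_iIndepFun {T : Type*} {X : T → Ω → ℝ}
    (hX : ∀ t, HasGaussianLaw (X t) P) (h : iIndepFun X P) : IsGaussianProcess X P where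
  hasGaussianLaw I :=
    iIndepFun.hasGaussianLaw (X := fun i : I ↦ X i) (fun i ↦ hX i)
      (h.precomp Subtype.val_injective)

/-- Linear combinations of a Gaussian process form a Gaussian process. -/
lemma isGaussianProcess_of_mem_span {S T : Type*} {X : T → Ω → ℝ} {Y : S → Ω → ℝ}
    (hX : IsGaussianProcess X P) (h : ∀ s, Y s ∈ Submodule.span ℝ (Set.range X)) :
    IsGaussianProcess Y P := by
  classical
  refine hX.of_isGaussianProcess fun s ↦ ?_
  obtain ⟨c, hc⟩ := (Finsupp.mem_span_range_iff_exists_finsupp).1 (h s)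
  refine ⟨c.support, LinearMap.toContinuousLinearMap
    { toFun := fun x ↦ ∑ i : c.support, c i * x i
      map_add' := fun x y ↦ by simp [mul_add, sum_add_distrib]
      map_smul' := fun r x ↦ by
        simp only [Pi.smul_apply, smul_eq_mul, mul_sum, RingHom.id_apply]
        exact sum_congr rfl fun i _ ↦ by ring }, fun ω ↦ ?_⟩
  rw [← hc, Finsupp.sum, ← sum_coe_sort]
  simp [Finset.restrict]

/-! ### Mutual information of a Gaussian regression -/

lemma log_gaussianPDFReal (μ : ℝ) {v : ℝ≥0} (hv : v ≠ 0) (x : ℝ) :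
    Real.log (gaussianPDFReal μ v x) =
      -(1 / 2 * Real.log (2 * Real.pi * v)) - (x - μ) ^ 2 / (2 * v) := by
  have hv' : (0 : ℝ) < v := by positivity
  rw [gaussianPDFReal, Real.log_mul (by positivity) (by positivity), Real.log_inv, Real.log_sqrt
    (by positivity), Real.log_exp]
  ring

/-- On each fibre over `y` the shear is a translation, under which Lebesgue measure is invariant.
Only the real coordinate needs a density; `ν` is arbitrary. -/
lemma map_add_prod_eq_withDensity {E : Type*} [MeasurableSpace E] {ν : Measure E} [SFinite ν]
    {h : E → ℝ} (hh : Measurable h) {c μ : ℝ} {v V : ℝ≥0} (hv : v ≠ 0) (hV : V ≠ 0) :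
    ((gaussianReal c v).prod ν).map (fun p ↦ (p.1 + h p.2, p.2)) =
      ((gaussianReal μ V).prod ν).withDensity
        fun p ↦ ENNReal.ofReal (gaussianPDFReal c v (p.1 - h p.2) / gaussianPDFReal μ V p.1) := by
  have hF : Measurable fun p : ℝ × E ↦
      ENNReal.ofReal (gaussianPDFReal c v (p.1 - h p.2) / gaussianPDFReal μ V p.1) := by
    have h1 := (measurable_gaussianPDFReal c v).comp
      (measurable_fst.sub (hh.comp measurable_snd) : Measurable fun p : ℝ × E ↦ p.1 - h p.2)
    have h2 := (measurable_gaussianPDFReal μ V).comp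
      (measurable_fst : Measurable (Prod.fst : ℝ × E → ℝ))
    exact (h1.div h2).ennreal_ofReal
  refine Measure.ext fun S hS ↦ ?_
  have hmap : Measurable fun p : ℝ × E ↦ (p.1 + h p.2, p.2) := by fun_prop
  have hind : Measurable (S.indicator (1 : ℝ × E → ℝ≥0∞)) := measurable_one.indicator hS
  have hcomp : Measurable fun p : ℝ × E ↦ S.indicator (1 : ℝ × E → ℝ≥0∞) (p.1 + h p.2, p.2) :=
    hind.comp hmap
  rw [withDensity_apply _ hS, ← lintegral_indicator_one hS, lintegral_map hind hmap,
    ← lintegral_indicator hS, lintegral_prod_symm' _ hcomp,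
    lintegral_prod_symm' _ (hF.indicator hS)]
  refine lintegral_congr fun y ↦ ?_
  have hcompy : Measurable fun x : ℝ ↦ S.indicator (1 : ℝ × E → ℝ≥0∞) (x + h y, y) :=
    hcomp.comp measurable_prodMk_right
  have hFy : Measurable fun x : ℝ ↦ S.indicator (fun p : ℝ × E ↦ ENNReal.ofReal
      (gaussianPDFReal c v (p.1 - h p.2) / gaussianPDFReal μ V p.1)) (x, y) :=
    (hF.indicator hS).comp measurable_prodMk_right
  rw [gaussianReal_of_var_ne_zero _ hv, gaussianReal_of_var_ne_zero _ hV,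
    lintegral_withDensity_eq_lintegral_mul _ (measurable_gaussianPDF _ _)
      hcompy,
    lintegral_withDensity_eq_lintegral_mul _ (measurable_gaussianPDF _ _)
      hFy, ← lintegral_sub_right_eq_self _ (h y)]
  refine lintegral_congr fun x ↦ ?_
  simp only [Pi.mul_apply, sub_add_cancel]
  by_cases hx : (x, y) ∈ S
  · simp only [Set.indicator_of_mem hx, Pi.one_apply, mul_one, gaussianPDF]
    rw [← ENNReal.ofReal_mul (gaussianPDFReal_nonneg _ _ _),
      mul_div_cancel₀ _ (gaussianPDFReal_pos μ V x hV).ne']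
  · simp [Set.indicator_of_notMem hx]

lemma integrable_sq_sub_of_hasLaw_gaussianReal {U : Ω → ℝ} {μ : ℝ} {V : ℝ≥0}
    (hU : HasLaw U (gaussianReal μ V) P) :
    Integrable (fun ω ↦ (U ω - μ) ^ 2) P ∧ ∫ ω, (U ω - μ) ^ 2 ∂P = V := by
  have hp : IsProbabilityMeasure P := hU.isProbabilityMeasure
  have hmem := hU.hasGaussianLaw.memLp_two
  refine ⟨(hmem.sub (memLp_const μ)).integrable_sq, ?_⟩
  have := variance_eq_integral hU.aemeasurable
  rw [hU.variance_eq, variance_id_gaussianReal, hU.integral_eq, integral_id_gaussianReal] at this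
  exact this.symm

/-- If `U = h(Y) + Z` is Gaussian of variance `V`, with a Gaussian error `Z` of variance `v`
independent of `Y`, then the mutual information of `U` and `Y` is `log (V / v) / 2`. -/
theorem mutualInfo_eq_of_regression {E : Type*} [MeasurableSpace E] {U Z : Ω → ℝ} {Y : Ω → E}
    {h : E → ℝ} {c μ : ℝ} {v V : ℝ≥0} (hv : v ≠ 0) (hV : V ≠ 0) (hY : AEMeasurable Y P)
    (hh : Measurable h) (hUZ : ∀ ω, U ω = Z ω + h (Y ω)) (hU : HasLaw U (gaussianReal μ V) P)
    (hZ : HasLaw Z (gaussianReal c v) P) (hind : IndepFun Z Y P) :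
    mutualInfo P U Y ≠ ∞ ∧ (mutualInfo P U Y).toReal = 1 / 2 * Real.log (V / v) := by
  have hp : IsProbabilityMeasure P := hU.isProbabilityMeasure
  have hpY : IsProbabilityMeasure (P.map Y) := Measure.isProbabilityMeasure_map hY
  have hm : AEMeasurable (fun ω ↦ (U ω, Y ω)) P := hU.aemeasurable.prodMk hY
  have hpUY : IsProbabilityMeasure (P.map fun ω ↦ (U ω, Y ω)) := Measure.isProbabilityMeasure_map hm
  set f : ℝ × E → ℝ := fun p ↦
    gaussianPDFReal c v (p.1 - h p.2) / gaussianPDFReal μ V p.1 with hf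
  have hfm : Measurable f := by
    have h1 := (measurable_gaussianPDFReal c v).comp
      (measurable_fst.sub (hh.comp measurable_snd) : Measurable fun p : ℝ × E ↦ p.1 - h p.2)
    have h2 := (measurable_gaussianPDFReal μ V).comp
      (measurable_fst : Measurable (Prod.fst : ℝ × E → ℝ))
    exact h1.div h2
  have hjoint : P.map (fun ω ↦ (U ω, Y ω)) =
      ((P.map U).prod (P.map Y)).withDensity fun p ↦ ENNReal.ofReal (f p) := by
    rw [hU.map_eq, hf, ← map_add_prod_eq_withDensity hh hv hV, ← hZ.map_eq,
      ← (indepFun_iff_map_prod_eq_prod_map_map hZ.aemeasurable hY).1 hind,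
      AEMeasurable.map_map_of_aemeasurable (by fun_prop) (hZ.aemeasurable.prodMk hY)]
    congr 1
    ext ω <;> simp [hUZ]
  have hac : P.map (fun ω ↦ (U ω, Y ω)) ≪ (P.map U).prod (P.map Y) := by
    rw [hjoint]
    exact withDensity_absolutelyContinuous _ _
  have hpU : IsProbabilityMeasure (P.map U) := Measure.isProbabilityMeasure_map hU.aemeasurable
  have hllr : llr (P.map fun ω ↦ (U ω, Y ω)) ((P.map U).prod (P.map Y))
      =ᵐ[P.map fun ω ↦ (U ω, Y ω)] fun p ↦ Real.log (f p) := by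
    have := Measure.rnDeriv_withDensity ((P.map U).prod (P.map Y)) hfm.ennreal_ofReal
    rw [← hjoint] at this
    filter_upwards [hac.ae_le this] with p hp
    rw [llr, hp, ENNReal.toReal_ofReal]
    exact div_nonneg (gaussianPDFReal_nonneg _ _ _) (gaussianPDFReal_nonneg _ _ _)
  -- The two quadratic terms each have expectation 1/2 and cancel after integration.
  have hlog : ∀ ω, Real.log (f (U ω, Y ω)) = 1 / 2 * Real.log (V / v) +
      ((2 * (V : ℝ))⁻¹ * (U ω - μ) ^ 2 - (2 * (v : ℝ))⁻¹ * (Z ω - c) ^ 2) := fun ω ↦ by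
    have hv' : (0 : ℝ) < v := by positivity
    have hV' : (0 : ℝ) < V := by positivity
    rw [hf]
    simp only
    rw [Real.log_div (gaussianPDFReal_pos _ _ _ hv).ne' (gaussianPDFReal_pos _ _ _ hV).ne',
      log_gaussianPDFReal _ hv, log_gaussianPDFReal _ hV, Real.log_mul (by positivity) hv'.ne',
      Real.log_mul (by positivity) hV'.ne', Real.log_div hV'.ne' hv'.ne',
      show U ω - h (Y ω) = Z ω by rw [hUZ]; ring]
    field_simp
    ring
  obtain ⟨iU, eU⟩ := integrable_sq_sub_of_hasLaw_gaussianReal hU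
  obtain ⟨iZ, eZ⟩ := integrable_sq_sub_of_hasLaw_gaussianReal hZ
  have hlogm : AEStronglyMeasurable (fun p ↦ Real.log (f p)) (P.map fun ω ↦ (U ω, Y ω)) :=
    (Real.measurable_log.comp hfm).aestronglyMeasurable
  have hint : Integrable (llr (P.map fun ω ↦ (U ω, Y ω)) ((P.map U).prod (P.map Y)))
      (P.map fun ω ↦ (U ω, Y ω)) := by
    rw [integrable_congr hllr, integrable_map_measure hlogm hm]
    refine Integrable.congr ?_ (ae_of_all _ fun ω ↦ (hlog ω).symm)
    exact (integrable_const _).add ((iU.const_mul _).sub (iZ.const_mul _))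
  refine ⟨klDiv_ne_top hac hint, ?_⟩
  rw [mutualInfo, toReal_klDiv_of_measure_eq hac (by simp), integral_congr_ae hllr,
    integral_map hm hlogm]
  simp_rw [hlog]
  have hsub : Integrable (fun ω ↦ (2 * (V : ℝ))⁻¹ * (U ω - μ) ^ 2 -
      (2 * (v : ℝ))⁻¹ * (Z ω - c) ^ 2) P := (iU.const_mul _).sub (iZ.const_mul _)
  rw [integral_add (integrable_const _) hsub,
    integral_sub (iU.const_mul _) (iZ.const_mul _), integral_const_mul (2 * (V : ℝ))⁻¹,
    integral_const_mul (2 * (v : ℝ))⁻¹, eU, eZ]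
  have hv' : (v : ℝ) ≠ 0 := by exact_mod_cast hv
  have hV' : (V : ℝ) ≠ 0 := by exact_mod_cast hV
  simp only [integral_const, probReal_univ, smul_eq_mul, one_mul]
  field_simp
  ring

/-! ### The stationary Ornstein-Uhlenbeck process at an increasing sequence of times -/

section Brownian

variable {W : ℝ≥0 → Ω → ℝ}

lemma covariance_increment (hW : IsPreBrownianReal W P) (a b c d : ℝ≥0) :
    cov[fun ω ↦ W b ω - W a ω, fun ω ↦ W d ω - W c ω; P] =
      (min b d : ℝ≥0) - (min b c : ℝ≥0) - (min a d : ℝ≥0) + (min a c : ℝ≥0) := by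
  have hm : ∀ t, MemLp (W t) 2 P := fun t ↦ (hW.isGaussianProcess.hasGaussianLaw_eval t).memLp_two
  have := hW.isGaussianProcess.isProbabilityMeasure
  rw [covariance_fun_sub_fun_sub (hm _) (hm _) (hm _) (hm _)]
  simp only [hW.covariance_eval]

lemma covariance_increment_self (hW : IsPreBrownianReal W P) {a b : ℝ≥0} (hab : a ≤ b) :
    cov[fun ω ↦ W b ω - W a ω, fun ω ↦ W b ω - W a ω; P] = (b : ℝ) - a := by
  rw [covariance_increment hW]
  simp [hab]

lemma covariance_increment_of_le (hW : IsPreBrownianReal W P) {a b c d : ℝ≥0} (hab : a ≤ b)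
    (hbc : b ≤ c) (hcd : c ≤ d) :
    cov[fun ω ↦ W b ω - W a ω, fun ω ↦ W d ω - W c ω; P] = 0 := by
  rw [covariance_increment hW, min_eq_left (hbc.trans hcd), min_eq_left hbc,
    min_eq_left (hab.trans (hbc.trans hcd)), min_eq_left (hab.trans hbc)]
  ring

/-- The sum that approximates the Wiener integral of `σ * exp (-κ (b - s))` over `[a, b]`. -/
noncomputable def wienerSum (W : ℝ≥0 → Ω → ℝ) (κ σ a b : ℝ) (n : ℕ) (ω : Ω) : ℝ :=
  ∑ k ∈ range (n + 1), (σ * Real.exp (-κ * (b - grid a b n k))) *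
    (W (grid a b n (k + 1)).toNNReal ω - W (grid a b n k).toNNReal ω)

variable {κ σ a b c d : ℝ}

lemma memLp_increment (hW : IsPreBrownianReal W P) (C : ℝ) (s t : ℝ≥0) :
    MemLp (fun ω ↦ C * (W t ω - W s ω)) 2 P :=
  ((hW.isGaussianProcess.hasGaussianLaw_eval t).memLp_two.sub
    (hW.isGaussianProcess.hasGaussianLaw_eval s).memLp_two).const_mul _

lemma integral_wienerSum (hW : IsPreBrownianReal W P) (n : ℕ) : P[wienerSum W κ σ a b n] = 0 := by
  have := hW.isGaussianProcess.isProbabilityMeasure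
  simp only [wienerSum]
  rw [integral_finsetSum _ fun k _ ↦ (memLp_increment hW _ _ _).integrable (by norm_num)]
  refine sum_eq_zero fun k _ ↦ ?_
  rw [integral_const_mul, integral_sub (hW.integrable_eval _) (hW.integrable_eval _),
    hW.integral_eval, hW.integral_eval, sub_zero, mul_zero]

lemma covariance_wienerSum_of_le (hW : IsPreBrownianReal W P) (hab : a ≤ b) (hbc : b ≤ c)
    (hcd : c ≤ d) (n : ℕ) : cov[wienerSum W κ σ a b n, wienerSum W κ σ c d n; P] = 0 := by
  have := hW.isGaussianProcess.isProbabilityMeasure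
  have e : cov[wienerSum W κ σ a b n, wienerSum W κ σ c d n; P] = _ :=
    covariance_fun_sum_fun_sum' (fun _ _ ↦ memLp_increment hW _ _ _)
      (fun _ _ ↦ memLp_increment hW _ _ _)
  rw [e]
  refine sum_eq_zero fun k hk ↦ sum_eq_zero fun l hl ↦ ?_
  rw [mem_range] at hk hl
  rw [covariance_const_mul_left, covariance_const_mul_right, covariance_increment_of_le hW]
  · simp
  · exact Real.toNNReal_le_toNNReal (grid_mono hab n (Nat.le_succ k))
  · exact Real.toNNReal_le_toNNReal
      ((grid_mem hab (by omega)).2.trans (hbc.trans (grid_mem hcd (by omega)).1))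
  · exact Real.toNNReal_le_toNNReal (grid_mono hcd n (Nat.le_succ l))

lemma covariance_wienerSum_self (hW : IsPreBrownianReal W P) (ha : 0 ≤ a) (hab : a ≤ b) (n : ℕ) :
    cov[wienerSum W κ σ a b n, wienerSum W κ σ a b n; P] = σ ^ 2 * ∑ k ∈ range (n + 1),
      Real.exp (-(2 * κ) * (b - grid a b n k)) * (grid a b n (k + 1) - grid a b n k) := by
  have := hW.isGaussianProcess.isProbabilityMeasure
  have e : cov[wienerSum W κ σ a b n, wienerSum W κ σ a b n; P] = _ :=
    covariance_fun_sum_fun_sum' (fun _ _ ↦ memLp_increment hW _ _ _)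
      (fun _ _ ↦ memLp_increment hW _ _ _)
  have hm : Monotone fun k ↦ (grid a b n k).toNNReal := fun k l h ↦
    Real.toNNReal_le_toNNReal (grid_mono hab n h)
  rw [e, mul_sum]
  refine sum_congr rfl fun k hk ↦ ?_
  rw [mem_range] at hk
  rw [sum_eq_single k]
  · rw [covariance_const_mul_left, covariance_const_mul_right,
      covariance_increment_self hW (hm (Nat.le_succ k)),
      Real.coe_toNNReal _ (ha.trans (grid_mem hab (by omega)).1),
      Real.coe_toNNReal _ (ha.trans (grid_mem hab (by omega)).1),
      show -(2 * κ) * (b - grid a b n k) =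
        -κ * (b - grid a b n k) + -κ * (b - grid a b n k) by ring, Real.exp_add]
    ring
  · intro l _ hlk
    rw [covariance_const_mul_left, covariance_const_mul_right]
    rcases lt_or_gt_of_ne hlk with h | h
    · rw [covariance_comm, covariance_increment_of_le hW (hm (Nat.le_succ l)) (hm h)
        (hm (Nat.le_succ k))]
      simp
    · rw [covariance_increment_of_le hW (hm (Nat.le_succ k)) (hm h) (hm (Nat.le_succ l))]
      simp
  · simp [mem_range.2 hk]

/-- The variances are sums of the same kind with rate `2 κ` and `w = id`; the constant path `(2
κ)⁻¹` solves the corresponding equation, so `tendsto_sum_exp_mul_increment` applies again. -/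
lemma tendsto_covariance_wienerSum_self (hW : IsPreBrownianReal W P) (hκ : κ ≠ 0) (ha : 0 ≤ a)
    (hab : a ≤ b) :
    Tendsto (fun n ↦ cov[wienerSum W κ σ a b n, wienerSum W κ σ a b n; P]) atTop
      (𝓝 (σ ^ 2 / (2 * κ) * (1 - Real.exp (-κ * (b - a)) ^ 2))) := by
  simp_rw [covariance_wienerSum_self hW ha hab]
  have := tendsto_sum_exp_mul_increment (κ := 2 * κ) hab (x := fun _ ↦ (2 * κ)⁻¹) (w := id)
    continuous_const (fun s _ t _ _ ↦ by simp; field_simp; ring)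
  convert! this.const_mul (σ ^ 2) using 2
  rw [← Real.exp_nat_mul,
    show ((2 : ℕ) : ℝ) * (-κ * (b - a)) = -(2 * κ) * (b - a) by push_cast; ring]
  field_simp

end Brownian

section OU

variable {κ θ σ : ℝ} {W X : ℝ≥0 → Ω → ℝ}

/-- The deterministic limit applied to almost every path, with `x = X - θ` and `w = σ W`. -/
lemma IsStationaryOU.ae_tendsto_wienerSum (H : IsStationaryOU P κ θ σ W X) {a b : ℝ≥0}
    (hab : a ≤ b) :
    ∀ᵐ ω ∂P, Tendsto (fun n ↦ wienerSum W κ σ a b n ω) atTop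
      (𝓝 ((X b ω - θ) - Real.exp (-κ * (b - a)) * (X a ω - θ))) := by
  filter_upwards [H.continuous, H.sde] with ω hc hs
  have hx : Continuous fun u : ℝ ↦ X u.toNNReal ω - θ :=
    (hc.comp continuous_real_toNNReal).sub continuous_const
  have := tendsto_sum_exp_mul_increment (κ := κ) (a := a) (b := b) (by exact_mod_cast hab)
    (w := fun u ↦ σ * W u.toNNReal ω) hx (fun s hs' t ht' hst ↦ by
      have h0s : 0 ≤ s := a.2.trans hs'.1
      have h0t : 0 ≤ t := a.2.trans ht'.1
      have es := hs s.toNNReal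
      have et := hs t.toNNReal
      rw [Real.coe_toNNReal _ h0s] at es
      rw [Real.coe_toNNReal _ h0t] at et
      have hi : ∀ u v : ℝ, IntervalIntegrable (fun s : ℝ ↦ κ * (θ - X s.toNNReal ω)) volume u v :=
        fun u v ↦ Continuous.intervalIntegrable
          (continuous_const.mul (continuous_const.sub (hc.comp continuous_real_toNNReal))) _ _
      have hadd := intervalIntegral.integral_add_adjacent_intervals (hi 0 s) (hi s t)
      have hneg : ∫ u in s..t, κ * (θ - X u.toNNReal ω) =
          -κ * ∫ u in s..t, (X u.toNNReal ω - θ) := by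
        rw [← intervalIntegral.integral_const_mul]
        congr 1 with u
        ring
      rw [← hneg]
      linarith)
  simp only [Real.toNNReal_coe] at this
  refine this.congr fun n ↦ sum_congr rfl fun k _ ↦ ?_
  ring

/-- The part of `X (r j)` that is not explained by the past `X (r 0), …, X (r (j - 1))`. -/
noncomputable def innovation (X : ℝ≥0 → Ω → ℝ) (κ θ : ℝ) (r : ℕ → ℝ≥0) : ℕ → Ω → ℝ
  | 0 => fun ω ↦ X (r 0) ω - θ
  | j + 1 => fun ω ↦ (X (r (j + 1)) ω - θ) -
      Real.exp (-κ * ((r (j + 1) : ℝ) - r j)) * (X (r j) ω - θ)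

/-- The approximations of the innovations. -/
noncomputable def approxInnovation (W X : ℝ≥0 → Ω → ℝ) (κ θ σ : ℝ) (r : ℕ → ℝ≥0) (n : ℕ) :
    ℕ → Ω → ℝ
  | 0 => fun ω ↦ X (r 0) ω - θ
  | j + 1 => wienerSum W κ σ (r j) (r (j + 1)) n

/-- The variances of the innovations. -/
noncomputable def innovationVar (κ σ : ℝ) (r : ℕ → ℝ≥0) : ℕ → ℝ
  | 0 => σ ^ 2 / (2 * κ)
  | j + 1 => σ ^ 2 / (2 * κ) * (1 - Real.exp (-κ * ((r (j + 1) : ℝ) - r j)) ^ 2)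

lemma IsStationaryOU.hasLaw_init_sub (H : IsStationaryOU P κ θ σ W X) :
    HasLaw (fun ω ↦ X 0 ω - θ) (gaussianReal 0 (σ ^ 2 / (2 * κ)).toNNReal) P := by
  simpa using gaussianReal_sub_const H.init_law θ

lemma IsStationaryOU.isGaussianProcess_base (H : IsStationaryOU P κ θ σ W X) :
    IsGaussianProcess (Sum.elim (fun (_ : Unit) ω ↦ X 0 ω - θ) W) P := by
  have hp := H.init_law.isProbabilityMeasure
  have hW : IsPreBrownianReal W P := H.brownian.toIsPreBrownianReal
  refine isGaussianProcess_sumElim ⟨fun I ↦ ?_⟩ hW.isGaussianProcess ?_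
  · exact H.hasLaw_init_sub.hasGaussianLaw.map
      (LinearMap.toContinuousLinearMap (LinearMap.pi fun _ : I ↦ LinearMap.id (M := ℝ) (R := ℝ)))
  · exact H.init_indep.comp (φ := fun x _ ↦ x - θ) (ψ := id) (by fun_prop) measurable_id

/-- The approximations are linear in the initial value and `W`. Their cross-covariances vanish, by
independence of the initial value or disjointness of the increments, and both facts pass to the
limit. Starting at `r 0 = 0` makes the initial value the first innovation. -/
lemma IsStationaryOU.isGaussianProcess_innovation (H : IsStationaryOU P κ θ σ W X) (hκ : 0 < κ)
    {r : ℕ → ℝ≥0} (hr : Monotone r) (hr0 : r 0 = 0) :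
    IsGaussianProcess (innovation X κ θ r) P ∧ (∀ j, P[innovation X κ θ r j] = 0) ∧
      ∀ i j, cov[innovation X κ θ r i, innovation X κ θ r j; P] =
        if i = j then innovationVar κ σ r i else 0 := by
  have hp := H.init_law.isProbabilityMeasure
  have hW : IsPreBrownianReal W P := H.brownian.toIsPreBrownianReal
  have hr' : ∀ {i j}, i ≤ j → (r i : ℝ) ≤ r j := fun h ↦ by exact_mod_cast hr h
  have hinit := H.hasLaw_init_sub
  refine isGaussianProcess_of_tendsto (U := approxInnovation W X κ θ σ r) (fun n ↦ ?_)
    (fun n j ↦ ?_) (fun i j ↦ ?_) fun j ↦ ?_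
  · refine isGaussianProcess_of_mem_span H.isGaussianProcess_base fun j ↦ ?_
    have hWmem : ∀ t, W t ∈ Submodule.span ℝ
        (Set.range (Sum.elim (fun (_ : Unit) ω ↦ X 0 ω - θ) W)) := fun t ↦
      Submodule.subset_span ⟨.inr t, rfl⟩
    cases j with
    | zero =>
      simp only [approxInnovation, hr0]
      exact Submodule.subset_span ⟨.inl (), rfl⟩
    | succ j =>
      have e : approxInnovation W X κ θ σ r n (j + 1) = ∑ k ∈ range (n + 1),
          (σ * Real.exp (-κ * (r (j + 1) - grid (r j) (r (j + 1)) n k))) •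
            (W (grid (r j) (r (j + 1)) n (k + 1)).toNNReal -
              W (grid (r j) (r (j + 1)) n k).toNNReal) := by
        ext ω
        simp [approxInnovation, wienerSum]
      rw [e]
      exact Submodule.sum_mem _ fun k _ ↦ Submodule.smul_mem _ _ (sub_mem (hWmem _) (hWmem _))
  · cases j with
    | zero =>
      simp only [approxInnovation, hr0]
      rw [hinit.integral_eq, integral_id_gaussianReal]
    | succ j => exact integral_wienerSum hW n
  · have h0 : ∀ j n, cov[approxInnovation W X κ θ σ r n 0,
        approxInnovation W X κ θ σ r n (j + 1); P] = 0 := fun j n ↦ by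
      simp only [approxInnovation, hr0]
      have e := covariance_fun_sum_right' (s := range (n + 1)) (μ := P)
        (X := fun k ω ↦ (σ * Real.exp (-κ * (r (j + 1) - grid (r j) (r (j + 1)) n k))) *
            (W (grid (r j) (r (j + 1)) n (k + 1)).toNNReal ω -
              W (grid (r j) (r (j + 1)) n k).toNNReal ω))
        (fun _ _ ↦ memLp_increment hW _ _ _) hinit.hasGaussianLaw.memLp_two
      refine e.trans (sum_eq_zero fun k _ ↦ ?_)
      refine IndepFun.covariance_eq_zero ?_ hinit.hasGaussianLaw.memLp_two
        (memLp_increment hW _ _ _)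
      exact H.init_indep.comp (φ := fun x ↦ x - θ) (ψ := fun w ↦
        (σ * Real.exp (-κ * (r (j + 1) - grid (r j) (r (j + 1)) n k))) *
            (w (grid (r j) (r (j + 1)) n (k + 1)).toNNReal -
              w (grid (r j) (r (j + 1)) n k).toNNReal)) (by fun_prop) (by fun_prop)
    cases i with
    | zero =>
      cases j with
      | zero =>
        simp only [approxInnovation, hr0, if_true, innovationVar]
        rw [covariance_self hinit.aemeasurable, hinit.variance_eq, variance_id_gaussianReal,
          Real.coe_toNNReal _ (by positivity)]
        exact tendsto_const_nhds
      | succ j => simp [h0]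
    | succ i =>
      cases j with
      | zero => simp [covariance_comm (approxInnovation W X κ θ σ r _ (i + 1)), h0]
      | succ j =>
        simp only [approxInnovation, add_left_inj]
        rcases lt_trichotomy i j with h | rfl | h
        · rw [if_neg h.ne]
          simp_rw [covariance_wienerSum_of_le hW (hr' (Nat.le_succ i)) (hr' (Nat.succ_le_of_lt h))
            (hr' (Nat.le_succ j))]
          exact tendsto_const_nhds
        · rw [if_pos rfl]
          exact tendsto_covariance_wienerSum_self hW hκ.ne' (r i).2 (hr' (Nat.le_succ i))
        · rw [if_neg h.ne']
          simp_rw [covariance_comm (wienerSum W κ σ (r i) _ _),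
            covariance_wienerSum_of_le hW (hr' (Nat.le_succ j)) (hr' (Nat.succ_le_of_lt h))
            (hr' (Nat.le_succ i))]
          exact tendsto_const_nhds
  · cases j with
    | zero => exact ae_of_all _ fun ω ↦ tendsto_const_nhds
    | succ j => exact H.ae_tendsto_wienerSum (hr (Nat.le_succ j))

lemma IsStationaryOU.isGaussianProcess_comp (H : IsStationaryOU P κ θ σ W X) (hκ : 0 < κ)
    {r : ℕ → ℝ≥0} (hr : Monotone r) (hr0 : r 0 = 0) :
    IsGaussianProcess (fun j ω ↦ X (r j) ω - θ) P := by
  obtain ⟨hG, -, -⟩ := H.isGaussianProcess_innovation hκ hr hr0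
  have hstep : ∀ j, (fun ω ↦ X (r (j + 1)) ω - θ) = innovation X κ θ r (j + 1) +
      Real.exp (-κ * ((r (j + 1) : ℝ) - r j)) • fun ω ↦ X (r j) ω - θ := fun j ↦ by
    ext ω
    simp [innovation]
  have hspan : ∀ j, (fun ω ↦ X (r j) ω - θ) ∈
      Submodule.span ℝ (Set.range (innovation X κ θ r)) := fun j ↦ by
    induction j with
    | zero => exact Submodule.subset_span ⟨0, rfl⟩
    | succ j ih =>
      rw [hstep]
      exact add_mem (Submodule.subset_span ⟨j + 1, rfl⟩) (Submodule.smul_mem _ _ ih)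
  exact isGaussianProcess_of_mem_span hG hspan

/-- A past state is a combination of past innovations, which are uncorrelated with the `j`-th. -/
lemma IsStationaryOU.covariance_innovation (H : IsStationaryOU P κ θ σ W X) (hκ : 0 < κ)
    {r : ℕ → ℝ≥0} (hr : Monotone r) (hr0 : r 0 = 0) {i j : ℕ} (hij : i < j) :
    cov[innovation X κ θ r j, fun ω ↦ X (r i) ω - θ; P] = 0 := by
  obtain ⟨hG, -, hcov⟩ := H.isGaussianProcess_innovation hκ hr hr0
  have hX := H.isGaussianProcess_comp hκ hr hr0
  have hp := hX.isProbabilityMeasure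
  induction i with
  | zero =>
    have := hcov j 0
    rwa [if_neg hij.ne'] at this
  | succ i ih =>
    have hstep : (fun ω ↦ X (r (i + 1)) ω - θ) = innovation X κ θ r (i + 1) +
        Real.exp (-κ * ((r (i + 1) : ℝ) - r i)) • fun ω ↦ X (r i) ω - θ := by
      ext ω
      simp [innovation]
    rw [hstep, covariance_add_right (hG.hasGaussianLaw_eval _).memLp_two
      (hG.hasGaussianLaw_eval _).memLp_two ((hX.hasGaussianLaw_eval i).memLp_two.const_smul _),
      hcov, if_neg hij.ne', covariance_smul_right, ih (by omega)]
    simp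

lemma IsStationaryOU.variance_eval (H : IsStationaryOU P κ θ σ W X) (hκ : 0 < κ)
    {r : ℕ → ℝ≥0} (hr : Monotone r) (hr0 : r 0 = 0) (j : ℕ) :
    cov[fun ω ↦ X (r j) ω - θ, fun ω ↦ X (r j) ω - θ; P] = σ ^ 2 / (2 * κ) := by
  obtain ⟨hG, -, hcov⟩ := H.isGaussianProcess_innovation hκ hr hr0
  have hX := H.isGaussianProcess_comp hκ hr hr0
  have hp := hX.isProbabilityMeasure
  induction j with
  | zero => simpa using! hcov 0 0
  | succ j ih =>
    have hstep : (fun ω ↦ X (r (j + 1)) ω - θ) = innovation X κ θ r (j + 1) +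
        Real.exp (-κ * ((r (j + 1) : ℝ) - r j)) • fun ω ↦ X (r j) ω - θ := by
      ext ω
      simp [innovation]
    have h1 := (hG.hasGaussianLaw_eval (j + 1)).memLp_two
    have h2 := (hX.hasGaussianLaw_eval j).memLp_two.const_smul
      (Real.exp (-κ * ((r (j + 1) : ℝ) - r j)))
    rw [hstep, covariance_add_left h1 h2 (h1.add h2), covariance_add_right h1 h1 h2,
      covariance_add_right h2 h1 h2, hcov, if_pos rfl, covariance_smul_right,
      H.covariance_innovation hκ hr hr0 (Nat.lt_succ_self j), covariance_smul_left,
      covariance_smul_left, covariance_smul_right, ih, covariance_comm,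
      H.covariance_innovation hκ hr hr0 (Nat.lt_succ_self j), innovationVar]
    ring

end OU

/-! ### The value of information -/

/-- The vector space of square integrable random variables. -/
def squareIntegrable (P : Measure Ω) : Submodule ℝ (Ω → ℝ) where
  carrier := {f | MemLp f 2 P}
  add_mem' hf hg := MemLp.add hf hg
  zero_mem' := MemLp.zero
  smul_mem' c _ hf := MemLp.const_smul hf c

/-- The covariance as a bilinear form. -/
noncomputable def covForm (P : Measure Ω) [IsFiniteMeasure P] :
    LinearMap.BilinForm ℝ (squareIntegrable P) :=
  LinearMap.mk₂ ℝ (fun f g ↦ cov[(f : Ω → ℝ), (g : Ω → ℝ); P])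
    (fun f g h ↦ covariance_add_left f.2 g.2 h.2) (fun c _ _ ↦ covariance_smul_left c)
    (fun f g h ↦ covariance_add_right f.2 g.2 h.2) (fun c _ _ ↦ covariance_smul_right c)

lemma covForm_apply [IsFiniteMeasure P] (f g : squareIntegrable P) :
    covForm P f g = cov[(f : Ω → ℝ), (g : Ω → ℝ); P] := rfl

section

variable {κ θ σ σn : ℝ} {W X : ℝ≥0 → Ω → ℝ} {N : ℕ → Ω → ℝ}

lemma IsChannelNoise.isGaussianProcess (hN : IsChannelNoise P σn X N) : IsGaussianProcess N P :=
  isGaussianProcess_of_iIndepFun (fun i ↦ (hN.law i).hasGaussianLaw) hN.indep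

lemma IsStationaryOU.isGaussianProcess_sumElim_noise (H : IsStationaryOU P κ θ σ W X)
    (hN : IsChannelNoise P σn X N) (hκ : 0 < κ) {r : ℕ → ℝ≥0} (hr : Monotone r) (hr0 : r 0 = 0) :
    IsGaussianProcess (Sum.elim (fun j ω ↦ X (r j) ω - θ) N) P :=
  isGaussianProcess_sumElim (H.isGaussianProcess_comp hκ hr hr0) hN.isGaussianProcess
    (hN.indep_process.comp (φ := fun x j ↦ x (r j) - θ) (ψ := id) (by fun_prop) measurable_id)

/-- The best linear prediction of the current status from the observations. -/
lemma IsStationaryOU.exists_linear_predictor (H : IsStationaryOU P κ θ σ W X)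
    (hN : IsChannelNoise P σn X N) (hκ : 0 < κ) (hσ : 0 < σ) (hσn : 0 < σn) {r : ℕ → ℝ≥0}
    (hr : Monotone r) (hr0 : r 0 = 0) {n m : ℕ} (hm : 2 ≤ m) (hmn : m ≤ n)
    (hlt : ∀ i, 1 ≤ i → i < n → r i < r (i + 1)) :
    ∃ (a : Fin m → ℝ) (ρ : ℝ),
      σ ^ 2 / (2 * κ) * (1 - Real.exp (-κ * ((r n : ℝ) - r (n - 1))) ^ 2) ≤ ρ ∧
      ρ ≤ σ ^ 2 / (2 * κ) * (1 - Real.exp (-κ * ((r n : ℝ) - r (n - 1))) ^ 2) +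
        Real.exp (-κ * ((r n : ℝ) - r (n - 1))) ^ 2 * σn ^ 2 ∧
      (∀ j : Fin m, cov[fun ω ↦ (X (r (n + 1)) ω - θ) -
          ∑ i : Fin m, a i * ((X (r (n - i)) ω - θ) + N (n - i) ω),
        fun ω ↦ (X (r (n - j)) ω - θ) + N (n - j) ω; P] = 0) ∧
      Var[fun ω ↦ (X (r (n + 1)) ω - θ) -
          ∑ i : Fin m, a i * ((X (r (n - i)) ω - θ) + N (n - i) ω); P] =
        σ ^ 2 / (2 * κ) * (1 - Real.exp (-κ * ((r (n + 1) : ℝ) - r n)) ^ 2) +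
          Real.exp (-κ * ((r (n + 1) : ℝ) - r n)) ^ 2 * (ρ * σn ^ 2 / (ρ + σn ^ 2)) := by
  have hX := H.isGaussianProcess_comp hκ hr hr0
  have hp := hX.isProbabilityMeasure
  have hNm : ∀ i, MemLp (N i) 2 P := fun i ↦ (hN.law i).hasGaussianLaw.memLp_two
  let x : ℕ → squareIntegrable P := fun j ↦
    ⟨fun ω ↦ X (r j) ω - θ, (hX.hasGaussianLaw_eval j).memLp_two⟩
  let ν : ℕ → squareIntegrable P := fun i ↦ ⟨N i, hNm i⟩
  have hss : IsStateSpace (covForm P) x ν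
      (fun j ↦ Real.exp (-κ * ((r (j + 1) : ℝ) - r j))) (σ ^ 2 / (2 * κ)) (σn ^ 2) :=
    { symm := fun u v ↦ covariance_comm _ _
      state_self := fun j ↦ H.variance_eval hκ hr hr0 j
      innovation := fun j i hij ↦ H.covariance_innovation hκ hr hr0 (Nat.lt_succ_of_le hij)
      noise_self := fun i ↦ by
        rw [covForm_apply, covariance_self (hN.law i).aemeasurable, (hN.law i).variance_eq,
          variance_id_gaussianReal, Real.coe_toNNReal _ (sq_nonneg σn)]
      noise_ne := fun i j hij ↦ (hN.indep.indepFun hij).covariance_eq_zero (hNm i) (hNm j)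
      state_noise := fun i j ↦ by
        refine IndepFun.covariance_eq_zero ?_ (x i).2 (hNm j)
        have hφ : Measurable fun x : ℝ≥0 → ℝ ↦ x (r i) - θ := by fun_prop
        have hψ : Measurable fun y : ℕ → ℝ ↦ y j := measurable_pi_apply j
        exact hN.indep_process.comp hφ hψ }
  -- `n + 1 - m` is the oldest update used: `m ≤ n` keeps it at least 1, and `2 ≤ m` puts it
  -- strictly before `n`.
  obtain ⟨h, hh, ho, ρ, h1, h2, h3⟩ := hss.exists_predictor (n := n) (k := n + 1 - m)
    (by positivity) (by positivity) (by omega) fun i hi hin ↦ by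
      have : (r i : ℝ) < r (i + 1) := by exact_mod_cast hlt i (by omega) hin
      have hlt1 : Real.exp (-κ * ((r (i + 1) : ℝ) - r i)) < 1 :=
        Real.exp_lt_one_iff.2 (by nlinarith)
      exact pow_lt_one₀ (Real.exp_nonneg _) hlt1 two_ne_zero
  have hset : (fun i ↦ x i + ν i) '' Set.Icc (n + 1 - m) n =
      Set.range fun j : Fin m ↦ x (n - j) + ν (n - j) := by
    ext y
    constructor
    · rintro ⟨i, ⟨hi1, hi2⟩, rfl⟩
      refine ⟨⟨n - i, by omega⟩, ?_⟩
      simp only [Nat.sub_sub_self hi2]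
    · rintro ⟨j, rfl⟩
      exact ⟨n - j, ⟨by have := j.2; omega, by omega⟩, rfl⟩
  rw [hset] at hh ho
  obtain ⟨a, ha⟩ := (Submodule.mem_span_range_iff_exists_fun ℝ).1 hh
  have hcoe : ((x (n + 1) - h : squareIntegrable P) : Ω → ℝ) = fun ω ↦ (X (r (n + 1)) ω - θ) -
      ∑ i : Fin m, a i * ((X (r (n - i)) ω - θ) + N (n - i) ω) := by
    ext ω
    rw [← ha]
    simp [x, ν, mul_add]
  have hn1 : n - 1 + 1 = n := by omega
  simp only [hn1] at h1 h2
  refine ⟨a, ρ, h1, h2, fun j ↦ ?_, ?_⟩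
  · have := ho _ ⟨j, rfl⟩
    rwa [covForm_apply, hcoe] at this
  · rw [covForm_apply, covariance_self (x (n + 1) - h).2.aemeasurable, hcoe] at h3
    exact h3

/-- The current time is placed at `r (n + 1)`, so that predicting the status is one more step of the
chain. Uncorrelated becomes independent because error and observations are jointly Gaussian. -/
theorem IsStationaryOU.voi_eq (H : IsStationaryOU P κ θ σ W X)
    (hN : IsChannelNoise P σn X N) (hκ : 0 < κ) (hσ : 0 < σ) (hσn : 0 < σn) {r : ℕ → ℝ≥0}
    (hr : Monotone r) (hr0 : r 0 = 0) {n m : ℕ} (hm : 2 ≤ m) (hmn : m ≤ n)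
    (hlt : ∀ i, 1 ≤ i → i < n + 1 → r i < r (i + 1)) :
    ∃ ρ : ℝ,
      σ ^ 2 / (2 * κ) * (1 - Real.exp (-κ * ((r n : ℝ) - r (n - 1))) ^ 2) ≤ ρ ∧
      ρ ≤ σ ^ 2 / (2 * κ) * (1 - Real.exp (-κ * ((r n : ℝ) - r (n - 1))) ^ 2) +
        Real.exp (-κ * ((r n : ℝ) - r (n - 1))) ^ 2 * σn ^ 2 ∧
      voi P X N r n m (r (n + 1)) ≠ ∞ ∧
      (voi P X N r n m (r (n + 1))).toReal = 1 / 2 * Real.log (σ ^ 2 / (2 * κ) /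
        (σ ^ 2 / (2 * κ) * (1 - Real.exp (-κ * ((r (n + 1) : ℝ) - r n)) ^ 2) +
          Real.exp (-κ * ((r (n + 1) : ℝ) - r n)) ^ 2 * (ρ * σn ^ 2 / (ρ + σn ^ 2)))) := by
  obtain ⟨a, ρ, h1, h2, hcov, hvar⟩ := H.exists_linear_predictor hN hκ hσ hσn hr hr0 hm hmn
    fun i hi hin ↦ hlt i hi (by omega)
  refine ⟨ρ, h1, h2, ?_⟩
  have hexp : ∀ i, 1 ≤ i → i < n + 1 → Real.exp (-κ * ((r (i + 1) : ℝ) - r i)) ^ 2 < 1 := by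
    intro i hi hin
    have : (r i : ℝ) < r (i + 1) := by exact_mod_cast hlt i hi hin
    exact pow_lt_one₀ (Real.exp_nonneg _) (Real.exp_lt_one_iff.2 (by nlinarith)) two_ne_zero
  have hs : 0 < σ ^ 2 / (2 * κ) := by positivity
  have hρ : 0 < ρ := by
    have := hexp (n - 1) (by omega) (by omega)
    rw [show n - 1 + 1 = n by omega] at this
    exact (mul_pos hs (by linarith)).trans_le h1
  set vz := σ ^ 2 / (2 * κ) * (1 - Real.exp (-κ * ((r (n + 1) : ℝ) - r n)) ^ 2) +
          Real.exp (-κ * ((r (n + 1) : ℝ) - r n)) ^ 2 * (ρ * σn ^ 2 / (ρ + σn ^ 2)) with hvz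
  have hvzpos : 0 < vz := by
    have := mul_pos hs (sub_pos.2 (hexp n (by omega) (by omega)))
    positivity
  have hX := H.isGaussianProcess_comp hκ hr hr0
  have hG := H.isGaussianProcess_sumElim_noise hN hκ hr hr0
  have hp := hX.isProbabilityMeasure
  set z : Ω → ℝ := fun ω ↦ (X (r (n + 1)) ω - θ) -
          ∑ i : Fin m, a i * ((X (r (n - i)) ω - θ) + N (n - i) ω) with hz
  set y : Fin m → Ω → ℝ := fun j ω ↦ (X (r (n - j)) ω - θ) + N (n - j) ω with hy
  have hxmem : ∀ j, (fun ω ↦ X (r j) ω - θ) ∈ Submodule.span ℝ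
      (Set.range (Sum.elim (fun j ω ↦ X (r j) ω - θ) N)) := fun j ↦
    Submodule.subset_span ⟨.inl j, rfl⟩
  have hymem : ∀ j, y j ∈ Submodule.span ℝ
      (Set.range (Sum.elim (fun j ω ↦ X (r j) ω - θ) N)) := fun j ↦
    add_mem (hxmem _) (Submodule.subset_span ⟨.inr (n - j), rfl⟩)
  have hzmem : z ∈ Submodule.span ℝ
      (Set.range (Sum.elim (fun j ω ↦ X (r j) ω - θ) N)) := by
    have : z = (fun ω ↦ X (r (n + 1)) ω - θ) - ∑ i, a i • y i := by
      ext ω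
      simp [hz, hy]
    rw [this]
    exact sub_mem (hxmem _) (Submodule.sum_mem _ fun i _ ↦ Submodule.smul_mem _ _ (hymem i))
  have hzy : IsGaussianProcess (Sum.elim (fun _ : Unit ↦ z) y) P :=
    isGaussianProcess_of_mem_span hG fun i ↦ by
      cases i with
      | inl _ => exact hzmem
      | inr j => exact hymem j
  have hzG : HasGaussianLaw z P := hzy.hasGaussianLaw_eval (.inl ())
  have hym : ∀ j, AEMeasurable (y j) P := fun j ↦ hzy.aemeasurable (.inr j)
  have hind := hzy.indepFun_of_covariance_eq_zero (fun _ ↦ hzG.aemeasurable) hym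
    fun _ j ↦ hcov j
  -- The prediction worked with centred variables; adding `θ` back preserves independence.
  have hobs : (fun ω (j : Fin m) ↦ obs X N r (n - j) ω) = fun ω j ↦ y j ω + θ := by
    ext ω j
    simp only [obs, hy]
    ring
  have hZind : IndepFun (fun ω ↦ θ + z ω) (fun ω (j : Fin m) ↦ obs X N r (n - j) ω) P := by
    rw [hobs]
    exact hind.comp (φ := fun u ↦ θ + u ()) (ψ := fun v j ↦ v j + θ) (by fun_prop) (by fun_prop)
  have hZlaw : HasLaw (fun ω ↦ θ + z ω) (gaussianReal (P[z] + θ) vz.toNNReal) P :=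
    gaussianReal_const_add ⟨hzG.aemeasurable, hvar ▸ hzG.map_eq_gaussianReal⟩ θ
  have hXlaw : HasLaw (X (r (n + 1)))
      (gaussianReal (P[fun ω ↦ X (r (n + 1)) ω - θ] + θ) (σ ^ 2 / (2 * κ)).toNNReal) P := by
    have hx := hX.hasGaussianLaw_eval (n + 1)
    have hv := H.variance_eval hκ hr hr0 (n + 1)
    rw [covariance_self hx.aemeasurable] at hv
    simpa using gaussianReal_add_const ⟨hx.aemeasurable, hv ▸ hx.map_eq_gaussianReal⟩ θ
  have hYm : AEMeasurable (fun ω (j : Fin m) ↦ obs X N r (n - j) ω) P := by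
    rw [hobs]
    exact aemeasurable_pi_lambda _ fun j ↦ (hym j).add_const θ
  have := mutualInfo_eq_of_regression (h := fun v : Fin m → ℝ ↦ ∑ i, a i * (v i - θ))
    (by simpa using hvzpos) (by simpa using hs) hYm (by fun_prop) (fun ω ↦ by
      simp only [hz, obs]
      rw [show ∑ i : Fin m, a i * (X (r (n - i)) ω + N (n - i) ω - θ) =
        ∑ i : Fin m, a i * ((X (r (n - i)) ω - θ) + N (n - i) ω) from
          sum_congr rfl fun i _ ↦ by ring]
      ring) hXlaw hZlaw hZind
  rwa [Real.coe_toNNReal _ hvzpos.le, Real.coe_toNNReal _ hs.le] at this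

end

/-! ### Poisson sampling -/

lemma ae_pos_expMeasure {lam : ℝ} : ∀ᵐ x ∂expMeasure lam, 0 < x := by
  have hm : Measurable (gammaPDF 1 lam) := (measurable_gammaPDFReal 1 lam).ennreal_ofReal
  rw [expMeasure, gammaMeasure, ae_withDensity_iff hm]
  filter_upwards [Measure.ae_ne volume (0 : ℝ)] with x hx hpdf
  by_contra h
  exact hpdf (gammaPDF_of_neg (lt_of_le_of_ne (not_lt.1 h) hx))

lemma IsPoissonSampling.ae_strictMono {S : Type*} [MeasurableSpace S] {Q : Measure S} {lam : ℝ}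
    {T : ℕ → S → ℝ≥0} (hT : IsPoissonSampling Q lam T) :
    ∀ᵐ s ∂Q, T 0 s = 0 ∧ StrictMono fun i ↦ T i s := by
  have h : ∀ i, ∀ᵐ s ∂Q, T i s < T (i + 1) s := fun i ↦ by
    have := ae_pos_expMeasure (lam := lam)
    rw [← (hT.law i).map_eq] at this
    filter_upwards [ae_of_ae_map (hT.law i).aemeasurable this] with s hs
    exact_mod_cast sub_pos.1 hs
  filter_upwards [hT.zero, ae_all_iff.2 h] with s h0 hs
  exact ⟨h0, strictMono_nat_of_lt_succ hs⟩

/-! ### The expansion of the value of information -/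

/-- Factoring out `1 - β` leaves two logarithms with arguments at least 1; `g ≤ c` ensures this for
the truncated expansion. Variances are in units of the stationary one. -/
lemma abs_log_expansion_le {β c g ρ : ℝ} (hβ0 : 0 < β) (hβ1 : β < 1) (hc : 0 < c) (hg : 0 < g)
    (hgc : g ≤ c) (h1 : c ≤ ρ) (h2 : ρ ≤ c + g) :
    |1 / 2 * Real.log (1 / ((1 - β) + β * (ρ * g / (ρ + g)))) -
      (1 / 2 * Real.log (1 / (1 - β)) -
        1 / 2 * Real.log (1 + β / (1 - β) * (g - 1 / c * g ^ 2)))| ≤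
      β / (1 - β) / c ^ 2 * g ^ 3 := by
  have hβ : 0 < 1 - β := by linarith
  have hρ : 0 < ρ := by linarith
  set p := ρ * g / (ρ + g) with hp
  have hp0 : 0 ≤ p := by positivity
  have hp1 : 0 ≤ g - 1 / c * g ^ 2 := by
    have : g - 1 / c * g ^ 2 = g * (c - g) / c := by field_simp
    rw [this]
    exact div_nonneg (mul_nonneg hg.le (by linarith)) hc.le
  have hA : 0 < β / (1 - β) := by positivity
  have e : 1 - β + β * p = (1 - β) * (1 + β / (1 - β) * p) := by field_simp
  rw [one_div (1 - β + β * p), one_div (1 - β), Real.log_inv, Real.log_inv, e,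
    Real.log_mul hβ.ne' (by positivity)]
  have e2 : 1 / 2 * -(Real.log (1 - β) + Real.log (1 + β / (1 - β) * p)) -
      (1 / 2 * -Real.log (1 - β) - 1 / 2 * Real.log (1 + β / (1 - β) * (g - 1 / c * g ^ 2))) =
      -(1 / 2 * (Real.log (1 + β / (1 - β) * p) -
        Real.log (1 + β / (1 - β) * (g - 1 / c * g ^ 2)))) := by ring
  rw [e2, abs_neg, abs_mul, abs_of_pos (by norm_num : (0 : ℝ) < 1 / 2)]
  have hlog := abs_log_sub_log_le (u := 1 + β / (1 - β) * p)
    (v := 1 + β / (1 - β) * (g - 1 / c * g ^ 2))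
    (le_add_of_nonneg_right (by positivity)) (le_add_of_nonneg_right (by positivity))
  rw [add_sub_add_left_eq_sub, ← mul_sub, abs_mul, abs_of_pos hA] at hlog
  calc 1 / 2 * _ ≤ 1 / 2 * (β / (1 - β) * (2 / c ^ 2 * g ^ 3)) := by
        gcongr
        exact hlog.trans (by gcongr; exact abs_harmonic_sub_expansion_le hc hg h1 h2)
    _ = _ := by ring

end NoisyOU

theorem corollary4 {S : Type*} [MeasurableSpace S] (Q : Measure S) [IsProbabilityMeasure Q]
    (lam κ : ℝ) (hlam : 0 < lam) (hκ : 0 < κ)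
    (T : ℕ → S → ℝ≥0) (hT : NoisyOU.IsPoissonSampling Q lam T) :
    ∀ᵐ s ∂Q, ∀ (t' : ℕ → ℝ≥0) (m n : ℕ) (t : ℝ≥0),
      (∀ i, 1 ≤ i → T i s < t' i) → t' n < t → t ≤ t' (n + 1) → 2 ≤ m → m ≤ n →
      ∃ C Γ : ℝ, 0 < Γ ∧
        ∀ (Ω : Type*) [MeasurableSpace Ω] (P : Measure Ω) [IsProbabilityMeasure P]
          (θ σ σn : ℝ) (W X : ℝ≥0 → Ω → ℝ) (N : ℕ → Ω → ℝ),
          0 < σ → 0 < σn → NoisyOU.IsStationaryOU P κ θ σ W X →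
          NoisyOU.IsChannelNoise P σn X N → Γ ≤ NoisyOU.snr κ σ σn →
          NoisyOU.voi P X N (fun i ↦ T i s) n m t ≠ ∞ ∧
          |(NoisyOU.voi P X N (fun i ↦ T i s) n m t).toReal -
              (1 / 2 * Real.log (1 / (1 - Real.exp (-2 * κ * ((t : ℝ) - T n s)))) -
                1 / 2 * Real.log (1 + 1 / (Real.exp (2 * κ * ((t : ℝ) - T n s)) - 1) *
                  (1 / NoisyOU.snr κ σ σn -
                    1 / (1 - Real.exp (-2 * κ * ((T n s : ℝ) - T (n - 1) s))) *
                      (1 / NoisyOU.snr κ σ σn ^ 2))))| ≤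
            C / NoisyOU.snr κ σ σn ^ 3 := by
  filter_upwards [hT.ae_strictMono] with s ⟨hs0, hsm⟩
  intro t' m n t ht' htn _ hm hmn
  have hTt : T n s < t := (ht' n (by omega)).trans htn
  have hTn : T (n - 1) s < T n s := hsm (by omega)
  have hTt' : (T n s : ℝ) < t := by exact_mod_cast hTt
  have hTn' : (T (n - 1) s : ℝ) < T n s := by exact_mod_cast hTn
  set β := Real.exp (-2 * κ * ((t : ℝ) - T n s)) with hβ
  set c := 1 - Real.exp (-2 * κ * ((T n s : ℝ) - T (n - 1) s)) with hc
  have hβ0 : 0 < β := Real.exp_pos _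
  have hβ1 : β < 1 := by
    rw [hβ, ← Real.exp_zero, Real.exp_lt_exp]
    nlinarith
  have hc0 : 0 < c := by
    rw [hc, sub_pos, ← Real.exp_zero, Real.exp_lt_exp]
    nlinarith
  -- The threshold `1 / c` on `γ` is the condition `g ≤ c` for `g = 1 / γ`.
  refine ⟨β / (1 - β) / c ^ 2, 1 / c, by positivity, ?_⟩
  intro Ω _ P _ θ σ σn W X N hσ hσn H hN hΓ
  -- The sampling times up to `n`, then `t` forever: the observations involve only indices at most
  -- `n`.
  let r : ℕ → ℝ≥0 := fun i ↦ if i ≤ n then T i s else t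
  have hrle : ∀ i, i ≤ n → r i = T i s := fun i hi ↦ if_pos hi
  have hrsucc : r (n + 1) = t := if_neg (by omega)
  have hlt : ∀ i, i < n + 1 → r i < r (i + 1) := fun i hi ↦ by
    rcases Nat.lt_succ_iff_lt_or_eq.1 hi with h | rfl
    · rw [hrle i h.le, hrle (i + 1) h]
      exact hsm (Nat.lt_succ_self i)
    · rwa [hrsucc, hrle i le_rfl]
  have hr : Monotone r := monotone_nat_of_le_succ fun i ↦ by
    rcases lt_or_ge i (n + 1) with h | h
    · exact (hlt i h).le
    · simp only [r]
      rw [if_neg (by omega), if_neg (by omega)]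
  have hr0 : r 0 = 0 := (hrle 0 (Nat.zero_le n)).trans hs0
  obtain ⟨ρ, h1, h2, h3, h4⟩ := H.voi_eq hN hκ hσ hσn hr hr0 hm hmn fun i _ hi ↦ hlt i hi
  have hvoi : NoisyOU.voi P X N r n m (r (n + 1)) = NoisyOU.voi P X N (fun i ↦ T i s) n m t := by
    rw [hrsucc]
    simp only [NoisyOU.voi, NoisyOU.obs, fun j : Fin m ↦ hrle (n - j) (Nat.sub_le _ _)]
  have hsq : ∀ d : ℝ, Real.exp (-κ * d) ^ 2 = Real.exp (-2 * κ * d) := fun d ↦ by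
    rw [← Real.exp_nat_mul]
    congr 1
    push_cast
    ring
  rw [hvoi] at h3 h4
  rw [hrle n le_rfl, hrle (n - 1) (Nat.sub_le _ _), hsq, ← hc] at h1 h2
  rw [hrle n le_rfl, hrsucc, hsq, ← hβ] at h4
  refine ⟨h3, ?_⟩
  set γ := NoisyOU.snr κ σ σn with hγ
  set v := σ ^ 2 / (2 * κ) with hv
  have hv0 : 0 < v := by positivity
  have hq : v / γ = σn ^ 2 := by
    rw [hγ, NoisyOU.snr, ← hv]
    field_simp
  have hγ0 : 0 < γ := lt_of_lt_of_le (by positivity) hΓ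
  have hexp : 1 / (Real.exp (2 * κ * ((t : ℝ) - T n s)) - 1) = β / (1 - β) := by
    have : Real.exp (2 * κ * ((t : ℝ) - T n s)) = 1 / β := by
      rw [hβ, one_div, ← Real.exp_neg]
      congr 1
      ring
    rw [this]
    have : 1 - β ≠ 0 := by linarith
    field_simp
  have hρ0 : 0 < ρ := lt_of_lt_of_le (by positivity) h1
  -- Dividing by the stationary variance `v` leaves `γ` and `ρ / v` as the only traces of the
  -- parameters `σ`, `σn`.
  have harg : v / (v * (1 - β) + β * (ρ * σn ^ 2 / (ρ + σn ^ 2))) =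
      1 / ((1 - β) + β * (ρ / v * (1 / γ) / (ρ / v + 1 / γ))) := by
    rw [← hq]
    have hb : 0 < 1 - β := by linarith
    have e : ρ * (v / γ) / (ρ + v / γ) = v * (ρ / v * (1 / γ) / (ρ / v + 1 / γ)) := by
      field_simp
    rw [e]
    field_simp
  rw [hexp, h4, harg]
  have key := NoisyOU.abs_log_expansion_le (ρ := ρ / v) (g := 1 / γ) hβ0 hβ1 hc0 (by positivity)
    (by rw [div_le_iff₀ hγ0]; rw [div_le_iff₀ hc0] at hΓ; linarith)
    (by rw [le_div_iff₀ hv0]; linarith)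
    (by
      rw [div_le_iff₀ hv0, add_mul, one_div_mul_eq_div, hq]
      -- The decay factor in front of the noise variance is bounded by 1, giving `ρ / v ≤ c + 1 /
      -- γ`.
      have : Real.exp (-2 * κ * ((T n s : ℝ) - T (n - 1) s)) ≤ 1 := by linarith
      nlinarith [sq_nonneg σn])
  rw [one_div_pow, one_div_pow] at key
  convert! key using 1
  ring
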